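/- Let $\mathcal X,\mathcal Y\subset\mathbb R^d$ be compact and convex, and let $\rho$ be a probability measure on $\mathcal X$ that has a density with respect to Lebesgue measure. Let $\mathcal P(\mathcal Y)$ be the set of Borel probability measures on $\mathcal Y$. For $\mu\in\mathcal P(\mathcal Y)$ let $T_\mu$ denote the solution of Monge's problem $$\min\Big\{\int_{\mathcal X}\|x-T(x)\|^2\,d\rho(x)\ :\ T:\mathcal X\to\mathcal Y \text{ measurable},\ T_\#\rho=\mu\Big\},$$ which exists and is unique up to equality $\rho$-almost everywhere; the map $\mu\mapsto T_\mu\in L^2(\rho,\mathbb R^d)$ is called the Monge embedding. For $p\ge 1$ and $\mu,\nu\in\mathcal P(\mathcal Y)$ let $$W_p(\mu,\nu)=\Big(\inf_{\gamma\in\Pi(\mu,\nu)}\int_{\mathcal Y\times\mathcal Y}\|y-y'\|^p\,d\gamma(y,y')\Big)^{1/p},$$ where $\Pi(\mu,\nu)$ is the set of measures on $\mathcal Y\times\mathcal Y$ with marginals $\mu$ and $\nu$. Then: (i) The Monge embedding is reverse-Lipschitz: $W_2(\mu,\nu)\le\|T_\mu-T_\nu\|_{L^2(\rho)}$ for all $\mu,\nu\in\mathcal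 P(\mathcal Y)$. (ii) The Monge embedding is continuous from $\mathcal P(\mathcal Y)$ to $L^2(\rho,\mathbb R^d)$, both when $\mathcal P(\mathcal Y)$ carries the topology of weak convergence of measures and when it carries the distance $W_p$, for every $p\ge1$. (iii) The Monge embedding is in general not better than $\frac12$-Hölder with respect to $W_2$. Namely, let $\mathcal X=\mathcal Y$ be the closed unit disc of $\mathbb R^2$, let $\rho$ be the uniform probability measure on it, and put $\mu_\theta=\frac12(\delta_{x_\theta}+\delta_{-x_\theta})$ with $x_\theta=(\cos\theta,\sin\theta)$. Then there is $C>0$ such that $$\|T_{\mu_\theta}-T_{\mu_0}\|_{L^2(\rho)}\ \ge\ C\,W_2(\mu_\theta,\mu_0)^{1/2}\qquad\text{for all }\theta\in[0,2\pi].$$ Moreover, for every $\alpha>\frac12$, every $C\ge0$ and every $\delta>0$ there is $\theta\in(0,\delta)$ with $\|T_{\mu_\theta}-T_{\mu_0}\|_{L^2(\rho)}>C\,W_2(\mu_\theta,\mu_0)^{\alpha}$; in particular, for no $\alpha>\frac12$ is there a constant $C$ with $\|T_\mu-T_\nu\|_{L^2(\rho)}\le C\,W_2(\mu,\nu)^\alpha$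 for all $\mu,\nu\in\mathcal P(\mathcal Y)$. -/

import Mathlib

open MeasureTheory Set Filter Topology
open scoped ENNReal NNReal

noncomputable section

/-- `T` solves Monge's problem between `ρ` and `μ` on `ℝᵈ` for the cost `‖x - y‖²`: it pushes `ρ`
forward to `μ` and has the least cost among all maps that do so.  If `μ` is carried by `Y`, every
such map takes its values in `Y` at `ρ`-almost every point. -/
structure IsMongeMap {d : ℕ} (ρ μ : Measure (EuclideanSpace ℝ (Fin d)))
    (T : EuclideanSpace ℝ (Fin d) → EuclideanSpace ℝ (Fin d)) : Prop where
  aemeasurable : AEMeasurable T ρ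
  map_eq : ρ.map T = μ
  cost_le : ∀ S : EuclideanSpace ℝ (Fin d) → EuclideanSpace ℝ (Fin d),
    AEMeasurable S ρ → ρ.map S = μ →
      ∫⁻ x, ‖x - T x‖ₑ ^ 2 ∂ρ ≤ ∫⁻ x, ‖x - S x‖ₑ ^ 2 ∂ρ

/-- The set `𝒫(Y)` of Borel probability measures on `ℝᵈ` that are carried by `Y`.  As a subtype of
`ProbabilityMeasure` it has the topology of weak convergence of measures. -/
def probOn {d : ℕ} (Y : Set (EuclideanSpace ℝ (Fin d))) :
    Set (ProbabilityMeasure (EuclideanSpace ℝ (Fin d))) :=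
  {μ | (μ : Measure (EuclideanSpace ℝ (Fin d))) Yᶜ = 0}

/-- The underlying measure of an element of `𝒫(Y)`. -/
abbrev measOf {d : ℕ} {Y : Set (EuclideanSpace ℝ (Fin d))} (μ : probOn Y) :
    Measure (EuclideanSpace ℝ (Fin d)) :=
  ((μ : ProbabilityMeasure (EuclideanSpace ℝ (Fin d))) : Measure (EuclideanSpace ℝ (Fin d)))

open Classical in
/-- The Monge embedding `μ ↦ T_μ ∈ L²(ρ, ℝᵈ)`: the solution of Monge's problem between `ρ` and `μ`,
as an element of `L²(ρ, ℝᵈ)` (and `0` if there were no solution). -/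
def mongeEmbedding {d : ℕ} (ρ : Measure (EuclideanSpace ℝ (Fin d)))
    {Y : Set (EuclideanSpace ℝ (Fin d))} (μ : probOn Y) :
    Lp (EuclideanSpace ℝ (Fin d)) 2 ρ :=
  if h : ∃ T : Lp (EuclideanSpace ℝ (Fin d)) 2 ρ, IsMongeMap ρ (measOf μ) T then h.choose else 0

/-- The transport plans (couplings) between `μ` and `ν`. -/
def transportPlans {d : ℕ} (μ ν : Measure (EuclideanSpace ℝ (Fin d))) :
    Set (Measure (EuclideanSpace ℝ (Fin d) × EuclideanSpace ℝ (Fin d))) :=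
  {γ | γ.map Prod.fst = μ ∧ γ.map Prod.snd = ν}

/-- The Wasserstein distance `W_p` on `𝒫(Y)`, with values in `[0, ∞]`. -/
def wasserstein {d : ℕ} {Y : Set (EuclideanSpace ℝ (Fin d))} (p : ℝ) (μ ν : probOn Y) : ℝ≥0∞ :=
  (⨅ γ ∈ transportPlans (measOf μ) (measOf ν), ∫⁻ z, ‖z.1 - z.2‖ₑ ^ p ∂γ) ^ (1 / p)

/-- The closed unit disc of the plane. -/
def unitDisc : Set (EuclideanSpace ℝ (Fin 2)) := Metric.closedBall 0 1

/-- The uniform probability measure on the unit disc. -/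
def uniformDisc : Measure (EuclideanSpace ℝ (Fin 2)) :=
  (volume unitDisc)⁻¹ • volume.restrict unitDisc

/-- The point `x_θ = (cos θ, sin θ)`. -/
def circlePoint (θ : ℝ) : EuclideanSpace ℝ (Fin 2) := !₂[Real.cos θ, Real.sin θ]

theorem norm_circlePoint (θ : ℝ) : ‖circlePoint θ‖ = 1 := by
  simp [circlePoint, EuclideanSpace.norm_eq, Fin.sum_univ_two]

/-- The measure `(δ_{x_θ} + δ_{-x_θ}) / 2`, as an element of `𝒫(unit disc)`. -/
def antipodalDiracs (θ : ℝ) : probOn unitDisc :=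
  ⟨⟨(2⁻¹ : ℝ≥0∞) • (Measure.dirac (circlePoint θ) + Measure.dirac (-circlePoint θ)),
    ⟨by simp [ENNReal.inv_two_add_inv_two]⟩⟩, by
    have hm : MeasurableSet (unitDiscᶜ) := Metric.isClosed_closedBall.measurableSet.compl
    have h1 : circlePoint θ ∈ unitDisc := by simp [unitDisc, norm_circlePoint]
    have h2 : -circlePoint θ ∈ unitDisc := by simp [unitDisc, norm_circlePoint]
    show ((2⁻¹ : ℝ≥0∞) • (Measure.dirac (circlePoint θ) + Measure.dirac (-circlePoint θ)))
      unitDiscᶜ = 0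
    simp [Measure.dirac_apply' _ hm, h1, h2]⟩

end

/-! Expanding the square turns Monge's problem into maximizing the correlation `∫ ⟪x, T x⟫ dρ`,
whose dual is to minimize `J(ψ) = ∫ ψ* dρ + ∫ ψ dμ` over continuous `ψ` on `Y`, where `ψ*` is the
Legendre transform. Since `ψ*` is Lipschitz, it is differentiable `ρ`-a.e. by Rademacher, and there
`∇ψ*(x)` is the unique maximizer of `⟪x, y⟫ - ψ y`. The first variation of `J` at a minimizer says
that `∇ψ*` pushes `ρ` to `μ` (`map_brenierMap_of_mem_dualMinimizers`), and the Fenchel–Young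
inequality, with its equality case, makes it the only optimal map (`brenierMap_optimal`).

Reverse-Lipschitz: the joint law of `(T_μ, T_ν)` under `ρ` is a transport plan.

Continuity: `J` is jointly continuous in `(ψ, μ)`, minimizers can be sought in a compact set of
potentials, and `ψ ↦ ∇ψ*` is continuous into `L²(ρ)`. A closed-graph argument along a compact
projection gives continuity for the weak topology (`continuous_mongeEmbedding`). The `W_p` case
follows because `W_p` controls integrals of bounded Lipschitz functions.

Failure of exponents above one half: for antipodal pairs the optimal map sends each point to the
nearer of the two. Rotating the pair by a small `θ` moves the masses by order `|sin θ|`, but flips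
the image of a sector of area of order `|sin θ|` by a distance bounded below. Thus `W₂` is at most
of order `|sin θ|`, and the `L²` distance at least of order `|sin θ|^(1/2)`. -/

noncomputable section

/-! ### Legendre transforms and their gradients -/

section Legendre

open BoundedContinuousFunction
open scoped RealInnerProductSpace Gradient

variable {E : Type*} [NormedAddCommGroup E] [InnerProductSpace ℝ E]

/-- The Legendre transform `x ↦ sup_{y ∈ Y} (⟪x, y⟫ - ψ y)` of a function on the set `Y`. -/
def legendre (Y : Set E) (ψ : Y →ᵇ ℝ) (x : E) : ℝ := ⨆ y : Y, (⟪x, (y : E)⟫ - ψ y)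

variable {Y : Set E} {ψ ψ' : Y →ᵇ ℝ}

theorem bddAbove_inner_sub (hY : IsCompact Y) (ψ : Y →ᵇ ℝ) (x : E) :
    BddAbove (range fun y : Y => ⟪x, (y : E)⟫ - ψ y) := by
  have := isCompact_iff_compactSpace.1 hY
  exact (isCompact_range (by fun_prop)).bddAbove

theorem inner_sub_le_legendre (hY : IsCompact Y) (ψ : Y →ᵇ ℝ) (x : E) (y : Y) :
    ⟪x, (y : E)⟫ - ψ y ≤ legendre Y ψ x :=
  le_ciSup (bddAbove_inner_sub hY ψ x) y

theorem legendre_le [Nonempty Y] {x : E} {a : ℝ} (h : ∀ y : Y, ⟪x, (y : E)⟫ - ψ y ≤ a) :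
    legendre Y ψ x ≤ a :=
  ciSup_le h

theorem exists_eq_legendre [Nonempty Y] (hY : IsCompact Y) (ψ : Y →ᵇ ℝ) (x : E) :
    ∃ y : Y, ⟪x, (y : E)⟫ - ψ y = legendre Y ψ x := by
  have := isCompact_iff_compactSpace.1 hY
  obtain ⟨y, -, hy⟩ := isCompact_univ.exists_isMaxOn (univ_nonempty (α := Y))
    (f := fun y : Y => ⟪x, (y : E)⟫ - ψ y) (by fun_prop)
  exact ⟨y, le_antisymm (inner_sub_le_legendre hY ψ x y) (legendre_le fun z => hy (mem_univ z))⟩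

theorem legendre_lipschitzWith [Nonempty Y] (hY : IsCompact Y) {R : ℝ≥0}
    (hR : ∀ y ∈ Y, ‖y‖ ≤ R) (ψ : Y →ᵇ ℝ) : LipschitzWith R (legendre Y ψ) := by
  refine LipschitzWith.of_le_add_mul R fun x x' => legendre_le fun y => ?_
  have h1 := inner_sub_le_legendre hY ψ x' y
  have h2 : ⟪x - x', (y : E)⟫ ≤ R * dist x x' := by
    rw [dist_eq_norm, mul_comm]
    exact (real_inner_le_norm _ _).trans (by gcongr; exact hR y y.2)
  rw [inner_sub_left] at h2
  linarith

theorem continuous_legendre [Nonempty Y] (hY : IsCompact Y) (ψ : Y →ᵇ ℝ) :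
    Continuous (legendre Y ψ) := by
  obtain ⟨R, hR⟩ := hY.isBounded.exists_norm_le
  exact (legendre_lipschitzWith hY (R := R.toNNReal)
    (fun y hy => (hR y hy).trans (Real.le_coe_toNNReal R)) ψ).continuous

theorem legendre_le_add_dist [Nonempty Y] (hY : IsCompact Y) (ψ ψ' : Y →ᵇ ℝ) (x : E) :
    legendre Y ψ x ≤ legendre Y ψ' x + dist ψ ψ' := by
  refine legendre_le fun y => ?_
  have h1 := inner_sub_le_legendre hY ψ' x y
  have h2 := (abs_le.1 (dist_coe_le_dist (f := ψ) (g := ψ') y)).1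
  linarith

theorem abs_legendre_sub_le [Nonempty Y] (hY : IsCompact Y) (ψ ψ' : Y →ᵇ ℝ) (x : E) :
    |legendre Y ψ x - legendre Y ψ' x| ≤ dist ψ ψ' := by
  have h1 := legendre_le_add_dist hY ψ ψ' x
  have h2 := legendre_le_add_dist hY ψ' ψ x
  rw [dist_comm] at h2
  exact abs_le.2 ⟨by linarith, by linarith⟩

theorem ae_differentiableAt_legendre [MeasurableSpace E] [BorelSpace E]
    [FiniteDimensional ℝ E] [Nonempty Y] (hY : IsCompact Y) {vol ρ : Measure E}
    [vol.IsAddHaarMeasure] (hρ : ρ ≪ vol) (ψ : Y →ᵇ ℝ) :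
    ∀ᵐ x ∂ρ, DifferentiableAt ℝ (legendre Y ψ) x := by
  obtain ⟨R, hR⟩ := hY.isBounded.exists_norm_le
  refine hρ.ae_le (LipschitzWith.ae_differentiableAt (C := R.toNNReal)
    (legendre_lipschitzWith hY (fun y hy => ?_) ψ))
  exact (hR y hy).trans (Real.le_coe_toNNReal R)

variable [CompleteSpace E]

/-- The gradient of the Legendre transform of `ψ`. -/
def brenierMap (Y : Set E) (ψ : Y →ᵇ ℝ) : E → E := ∇ (legendre Y ψ)

/-- If `y` attains the supremum at `x`, then `z ↦ ψ*(z) - ⟪y, z⟫` is minimal at `x`, so its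
derivative vanishes there. In particular the maximizer is unique at points of differentiability. -/
theorem brenierMap_eq_of_isMax (hY : IsCompact Y) {x : E}
    (hx : DifferentiableAt ℝ (legendre Y ψ) x) (y : Y)
    (hy : ⟪x, (y : E)⟫ - ψ y = legendre Y ψ x) : brenierMap Y ψ x = y := by
  have hmin : IsLocalMin (fun z => legendre Y ψ z - ⟪(y : E), z⟫) x := by
    refine Eventually.of_forall fun z => ?_
    have := inner_sub_le_legendre hY ψ z y
    simp only [real_inner_comm (y : E)] at this hy ⊢
    linarith
  have hd : HasFDerivAt (fun z => legendre Y ψ z - ⟪(y : E), z⟫)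
      (fderiv ℝ (legendre Y ψ) x - innerSL ℝ (y : E)) x :=
    hx.hasFDerivAt.sub (innerSL ℝ (y : E)).hasFDerivAt
  have h0 := hmin.hasFDerivAt_eq_zero hd
  rw [sub_eq_zero] at h0
  rw [brenierMap, gradient, h0, LinearIsometryEquiv.symm_apply_eq]
  rfl

theorem exists_brenierMap_eq [Nonempty Y] (hY : IsCompact Y) {x : E}
    (hx : DifferentiableAt ℝ (legendre Y ψ) x) :
    ∃ y : Y, brenierMap Y ψ x = y ∧ ⟪x, (y : E)⟫ - ψ y = legendre Y ψ x := by
  obtain ⟨y, hy⟩ := exists_eq_legendre hY ψ x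
  exact ⟨y, brenierMap_eq_of_isMax hY hx y hy, hy⟩

theorem norm_brenierMap_le [Nonempty Y] (hY : IsCompact Y) {R : ℝ≥0}
    (hR : ∀ y ∈ Y, ‖y‖ ≤ R) (ψ : Y →ᵇ ℝ) (x : E) : ‖brenierMap Y ψ x‖ ≤ R := by
  rw [brenierMap, gradient, LinearIsometryEquiv.norm_map]
  exact norm_fderiv_le_of_lipschitz ℝ (legendre_lipschitzWith hY hR ψ)

/-- Maximizers for `ψs i` are almost maximizers for `ψ`. By compactness of `Y` they have cluster
points, each of which maximizes for `ψ`, and that maximizer is unique. -/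
theorem tendsto_brenierMap [Nonempty Y] (hY : IsCompact Y) {ι : Type*} {l : Filter ι}
    {ψs : ι → Y →ᵇ ℝ} (hψ : Tendsto ψs l (𝓝 ψ)) {x : E}
    (hx : DifferentiableAt ℝ (legendre Y ψ) x)
    (hxs : ∀ᶠ i in l, DifferentiableAt ℝ (legendre Y (ψs i)) x) :
    Tendsto (fun i => brenierMap Y (ψs i) x) l (𝓝 (brenierMap Y ψ x)) := by
  have := isCompact_iff_compactSpace.1 hY
  choose y hy using fun i => exists_eq_legendre hY (ψs i) x
  obtain ⟨z, hz, hzx⟩ := exists_brenierMap_eq hY hx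
  have hval : Tendsto (fun i => ⟪x, (y i : E)⟫ - ψ (y i)) l (𝓝 (legendre Y ψ x)) := by
    have hd : Tendsto (fun i => 2 * dist (ψs i) ψ) l (𝓝 0) := by
      simpa using (tendsto_iff_dist_tendsto_zero.1 hψ).const_mul 2
    rw [tendsto_iff_dist_tendsto_zero]
    refine squeeze_zero (fun _ => dist_nonneg) (fun i => ?_) hd
    have h1 := abs_le.1 (abs_legendre_sub_le hY (ψs i) ψ x)
    have h2 := abs_le.1 (dist_coe_le_dist (f := ψs i) (g := ψ) (y i))
    have h3 := hy i
    rw [Real.dist_eq, abs_le]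
    constructor <;> linarith
  have key : Tendsto y l (𝓝 z) := by
    refine tendsto_nhds_of_unique_mapClusterPt fun w hw => ?_
    have hcont : Continuous fun y : Y => ⟪x, (y : E)⟫ - ψ y := by fun_prop
    have hc := hw.continuousAt_comp hcont.continuousAt
    have he : ⟪x, (w : E)⟫ - ψ w = legendre Y ψ x :=
      eq_of_nhds_neBot (hc.neBot.mono (inf_le_inf_left _ hval))
    exact Subtype.ext ((brenierMap_eq_of_isMax hY hx w he).symm.trans hz)
  rw [hz]
  refine ((continuous_subtype_val.tendsto z).comp key).congr' ?_
  filter_upwards [hxs] with i hi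
  exact (brenierMap_eq_of_isMax hY hi (y i) (hy i)).symm

section Measure

variable [MeasurableSpace E] [BorelSpace E]

theorem measurable_brenierMap (Y : Set E) (ψ : Y →ᵇ ℝ) :
    Measurable (brenierMap Y ψ) :=
  (InnerProductSpace.toDual ℝ E).symm.continuous.measurable.comp (measurable_fderiv ℝ _)

end Measure

end Legendre

/-! ### The dual problem: existence of minimizers and their first variation -/

section Dual

open BoundedContinuousFunction
open scoped RealInnerProductSpace Gradient

theorem ae_mem_of_compl_null {α : Type*} [MeasurableSpace α] {ρ : Measure α} {X : Set α}
    (h : ρ Xᶜ = 0) : ∀ᵐ x ∂ρ, x ∈ X :=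
  h

theorem integrable_of_continuous_of_compl_null {E F : Type*} [MetricSpace E] [MeasurableSpace E]
    [BorelSpace E] [NormedAddCommGroup F] [SecondCountableTopology F] {ρ : Measure E}
    [IsFiniteMeasure ρ] {X : Set E} (hX : IsCompact X)
    (hρX : ρ Xᶜ = 0) {f : E → F} (hf : Continuous f) : Integrable f ρ := by
  have := hf.continuousOn.integrableOn_compact (μ := ρ) hX
  rwa [IntegrableOn, Measure.restrict_eq_self_of_ae_mem (ae_mem_of_compl_null hρX)] at this

/-- The functions on `Y` that are `M`-Lipschitz and vanish at a base point. -/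
def normalizedPotentials {E : Type*} [MetricSpace E] (Y : Set E) (M : ℝ≥0) (y₀ : Y) :
    Set (Y →ᵇ ℝ) :=
  {ψ | LipschitzWith M ψ ∧ ψ y₀ = 0}

/-- Arzelà–Ascoli: a common Lipschitz constant gives equicontinuity, and vanishing at `y₀` gives a
uniform bound by `M` times the diameter of `Y`. -/
theorem isCompact_normalizedPotentials {E : Type*} [MetricSpace E] {Y : Set E} (hY : IsCompact Y)
    (M : ℝ≥0) (y₀ : Y) : IsCompact (normalizedPotentials Y M y₀) := by
  have := isCompact_iff_compactSpace.1 hY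
  refine arzela_ascoli₂ (Metric.closedBall 0 (M * Metric.diam Y)) (isCompact_closedBall _ _) _
    ?_ ?_ ?_
  · have h : normalizedPotentials Y M y₀ =
        (⋂ (y : Y) (z : Y), {ψ : Y →ᵇ ℝ | dist (ψ y) (ψ z) ≤ M * dist y z}) ∩
          {ψ | ψ y₀ = 0} := by
      ext ψ
      simp [normalizedPotentials, lipschitzWith_iff_dist_le_mul]
    rw [h]
    refine (isClosed_iInter fun y => isClosed_iInter fun z => isClosed_le ?_ continuous_const).inter
      (isClosed_eq (continuous_eval_const y₀) continuous_const)
    exact (continuous_eval_const y).dist (continuous_eval_const z)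
  · intro ψ y hψ
    rw [mem_closedBall_zero_iff, ← sub_zero (ψ y), ← hψ.2, ← dist_eq_norm]
    refine (hψ.1.dist_le_mul y y₀).trans ?_
    gcongr
    exact Metric.dist_le_diam_of_mem hY.isBounded y.2 y₀.2
  · exact (LipschitzWith.uniformEquicontinuous _ M fun ψ => ψ.2.1).equicontinuous

variable {E : Type*} [NormedAddCommGroup E] [InnerProductSpace ℝ E] [MeasurableSpace E]
  [BorelSpace E]

/-- The functional `ψ ↦ ∫ ψ* dρ + ∫ ψ dm` of the dual problem. -/
def dualFunctional {Y : Set E} (ρ : Measure E) (m : Measure Y) (ψ : Y →ᵇ ℝ) : ℝ :=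
  ∫ x, legendre Y ψ x ∂ρ + ∫ y, ψ y ∂m

/-- The minimizers of the dual functional. -/
def dualMinimizers {Y : Set E} (ρ : Measure E) (m : Measure Y) : Set (Y →ᵇ ℝ) :=
  {ψ | ∀ ψ' : Y →ᵇ ℝ, dualFunctional ρ m ψ ≤ dualFunctional ρ m ψ'}

variable {X Y : Set E} {ρ : Measure E} {m : Measure Y}

theorem dualFunctional_lipschitzWith [Nonempty Y] [IsProbabilityMeasure ρ]
    [IsProbabilityMeasure m] (hX : IsCompact X) (hY : IsCompact Y) (hρX : ρ Xᶜ = 0) :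
    LipschitzWith 2 (dualFunctional ρ m) := by
  refine LipschitzWith.of_le_add_mul 2 fun ψ ψ' => ?_
  have h1 : ∫ x, legendre Y ψ x ∂ρ ≤ ∫ x, (legendre Y ψ' x + dist ψ ψ') ∂ρ :=
    integral_mono (integrable_of_continuous_of_compl_null hX hρX (continuous_legendre hY ψ))
      ((integrable_of_continuous_of_compl_null hX hρX (continuous_legendre hY ψ')).add
        (integrable_const _)) fun x => legendre_le_add_dist hY ψ ψ' x
  have h2 : ∫ y, ψ y ∂m ≤ ∫ y, (ψ' y + dist ψ ψ') ∂m := by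
    refine integral_mono (ψ.integrable m) ((ψ'.integrable m).add (integrable_const _)) fun y => ?_
    have := abs_le.1 (dist_coe_le_dist (f := ψ) (g := ψ') y)
    show ψ y ≤ ψ' y + dist ψ ψ'
    linarith
  rw [integral_add (integrable_of_continuous_of_compl_null hX hρX (continuous_legendre hY ψ'))
    (integrable_const _), integral_const] at h1
  rw [integral_add (ψ'.integrable m) (integrable_const _), integral_const] at h2
  simp only [probReal_univ, one_smul] at h1 h2
  simp only [dualFunctional, NNReal.coe_ofNat]
  linarith

/-- Replacing `ψ` by its double transform `ψ**`, with the inner supremum over `X`, does not increase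
either integral, and makes it `M`-Lipschitz because `X` lies in the ball of radius `M`. Subtracting
a constant leaves the functional unchanged, as both measures have mass one. -/
theorem exists_normalized_dualFunctional_le [Nonempty Y] [IsProbabilityMeasure ρ]
    [IsProbabilityMeasure m] (hX : IsCompact X) (hY : IsCompact Y) (hρX : ρ Xᶜ = 0) {M : ℝ≥0}
    (hM : ∀ x ∈ X, ‖x‖ ≤ M) (y₀ : Y) (ψ : Y →ᵇ ℝ) :
    ∃ ψ' ∈ normalizedPotentials Y M y₀, dualFunctional ρ m ψ' ≤ dualFunctional ρ m ψ := by
  -- The transform over `X` is a supremum that needs a nonempty index set; `X` has full mass.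
  have hne : Nonempty X := by
    have := (ae_mem_of_compl_null hρX).exists
    exact ⟨⟨this.choose, this.choose_spec⟩⟩
  have := isCompact_iff_compactSpace.1 hX
  have := isCompact_iff_compactSpace.1 hY
  let φ : X →ᵇ ℝ :=
    mkOfCompact ⟨fun x => legendre Y ψ x, (continuous_legendre hY ψ).comp continuous_subtype_val⟩
  have hχ := legendre_lipschitzWith hX hM φ
  let ψ' : Y →ᵇ ℝ :=
    mkOfCompact ⟨fun y => legendre X φ y - legendre X φ y₀, by
      have := hχ.continuous; fun_prop⟩
  have hψ' (y : Y) : ψ' y = legendre X φ y - legendre X φ y₀ := rfl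
  refine ⟨ψ', ⟨LipschitzWith.of_dist_le_mul fun y z => ?_, by simp [hψ']⟩, ?_⟩
  · rw [hψ', hψ', dist_sub_right]
    exact hχ.dist_le_mul _ _
  have h1 : ∫ x, legendre Y ψ' x ∂ρ ≤ ∫ x, (legendre Y ψ x + legendre X φ y₀) ∂ρ := by
    refine integral_mono_ae
      (integrable_of_continuous_of_compl_null hX hρX (continuous_legendre hY ψ'))
      ((integrable_of_continuous_of_compl_null hX hρX (continuous_legendre hY ψ)).add
        (integrable_const _)) ?_
    filter_upwards [ae_mem_of_compl_null hρX] with x hx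
    refine legendre_le fun y => ?_
    have h : ⟪(y : E), x⟫ - legendre Y ψ x ≤ legendre X φ y := inner_sub_le_legendre hX φ y ⟨x, hx⟩
    rw [real_inner_comm] at h
    rw [hψ']
    linarith
  have h2 : ∫ y, ψ' y ∂m ≤ ∫ y, (ψ y - legendre X φ y₀) ∂m := by
    refine integral_mono (ψ'.integrable m) ((ψ.integrable m).sub (integrable_const _)) fun y => ?_
    have h : legendre X φ y ≤ ψ y := by
      refine legendre_le fun x => ?_
      have h : ⟪(x : E), (y : E)⟫ - ψ y ≤ legendre Y ψ x := inner_sub_le_legendre hY ψ x y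
      rw [real_inner_comm] at h
      show _ - legendre Y ψ x ≤ _
      linarith
    show ψ' y ≤ ψ y - legendre X φ y₀
    rw [hψ']
    linarith
  rw [integral_add (integrable_of_continuous_of_compl_null hX hρX (continuous_legendre hY ψ))
    (integrable_const _), integral_const] at h1
  rw [integral_sub (ψ.integrable m) (integrable_const _), integral_const] at h2
  simp only [probReal_univ, one_smul] at h1 h2
  simp only [dualFunctional]
  linarith

theorem exists_normalized_dualMinimizer [Nonempty Y] [IsProbabilityMeasure ρ]
    [IsProbabilityMeasure m] (hX : IsCompact X) (hY : IsCompact Y) (hρX : ρ Xᶜ = 0) {M : ℝ≥0}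
    (hM : ∀ x ∈ X, ‖x‖ ≤ M) (y₀ : Y) :
    ∃ ψ ∈ normalizedPotentials Y M y₀, ψ ∈ dualMinimizers ρ m := by
  obtain ⟨ψ, hψ, hmin⟩ := (isCompact_normalizedPotentials hY M y₀).exists_isMinOn
    ⟨0, LipschitzWith.const' 0, rfl⟩
    (dualFunctional_lipschitzWith (m := m) hX hY hρX).continuous.continuousOn
  refine ⟨ψ, hψ, fun ψ' => ?_⟩
  obtain ⟨ψ'', h, hle⟩ := exists_normalized_dualFunctional_le (m := m) hX hY hρX hM y₀ ψ'
  exact (hmin h).trans hle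

variable [FiniteDimensional ℝ E] [CompleteSpace E] {vol : Measure E} [vol.IsAddHaarMeasure]

theorem ae_tendsto_brenierMap [Nonempty Y] (hY : IsCompact Y) (hρ : ρ ≪ vol)
    {ψs : ℕ → Y →ᵇ ℝ} {ψ : Y →ᵇ ℝ} (hψ : Tendsto ψs atTop (𝓝 ψ)) :
    ∀ᵐ x ∂ρ, Tendsto (fun n => brenierMap Y (ψs n) x) atTop (𝓝 (brenierMap Y ψ x)) := by
  filter_upwards [ae_differentiableAt_legendre hY hρ ψ,
    ae_all_iff.2 fun n => ae_differentiableAt_legendre hY hρ (ψs n)] with x hx hxs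
  exact tendsto_brenierMap hY hψ hx (Eventually.of_forall hxs)

/-- One-sided first variation along `ψ + t h`. Testing `ψ*` at the maximizer of the perturbed
problem gives `(ψ + t h)* ≤ ψ* - t h(T_t)` a.e., where `T_t = ∇(ψ + t h)*`. Minimality then yields
`∫ h(T_t) dρ ≤ ∫ h dm`, and `t → 0` by dominated convergence. Differentiability of the functional
itself is never needed. -/
theorem integral_comp_brenierMap_le [Nonempty Y] [IsProbabilityMeasure ρ]
    [IsProbabilityMeasure m] (hX : IsCompact X) (hY : IsCompact Y) (hρ : ρ ≪ vol)
    (hρX : ρ Xᶜ = 0) {ψ : Y →ᵇ ℝ} (hψ : ψ ∈ dualMinimizers ρ m) (h : E →ᵇ ℝ) :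
    ∫ x, h (brenierMap Y ψ x) ∂ρ ≤ ∫ y, h y ∂m := by
  let k : Y →ᵇ ℝ := h.compContinuous ⟨Subtype.val, continuous_subtype_val⟩
  let ψs (n : ℕ) : Y →ᵇ ℝ := ψ + (1 / ((n : ℝ) + 1)) • k
  have hlim : Tendsto ψs atTop (𝓝 ψ) := by
    have := (tendsto_one_div_add_atTop_nhds_zero_nat (𝕜 := ℝ)).smul_const k
    simpa [ψs] using this.const_add ψ
  have hmeas (χ : Y →ᵇ ℝ) : AEStronglyMeasurable (fun x => h (brenierMap Y χ x)) ρ :=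
    (h.continuous.measurable.comp (measurable_brenierMap Y χ)).aestronglyMeasurable
  have hbound (χ : Y →ᵇ ℝ) : ∀ᵐ x ∂ρ, ‖h (brenierMap Y χ x)‖ ≤ ‖h‖ :=
    Eventually.of_forall fun x => h.norm_coe_le_norm _
  have hint (χ : Y →ᵇ ℝ) : Integrable (fun x => h (brenierMap Y χ x)) ρ :=
    (integrable_const ‖h‖).mono' (hmeas χ) (hbound χ)
  have hconv : Tendsto (fun n => ∫ x, h (brenierMap Y (ψs n) x) ∂ρ) atTop
      (𝓝 (∫ x, h (brenierMap Y ψ x) ∂ρ)) := by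
    refine tendsto_integral_of_dominated_convergence (fun _ => ‖h‖) (fun n => hmeas _)
      (integrable_const _) (fun n => hbound _) ?_
    filter_upwards [ae_tendsto_brenierMap hY hρ hlim] with x hx
    exact (h.continuous.tendsto _).comp hx
  refine le_of_tendsto' hconv fun n => ?_
  set t : ℝ := 1 / ((n : ℝ) + 1) with ht
  have ht0 : 0 < t := by positivity
  have hI := integrable_of_continuous_of_compl_null hX hρX (continuous_legendre hY ψ)
  have h1 : ∫ x, legendre Y (ψs n) x ∂ρ ≤
      ∫ x, (legendre Y ψ x - t * h (brenierMap Y (ψs n) x)) ∂ρ := by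
    refine integral_mono_ae
      (integrable_of_continuous_of_compl_null hX hρX (continuous_legendre hY (ψs n)))
      (hI.sub ((hint _).const_mul t)) ?_
    filter_upwards [ae_differentiableAt_legendre hY hρ (ψs n)] with x hx
    obtain ⟨y, hy, hyx⟩ := exists_brenierMap_eq hY hx
    have h2 := inner_sub_le_legendre hY ψ x y
    have h3 : ψs n y = ψ y + t * h y := rfl
    rw [← hyx, hy, h3]
    linarith
  rw [integral_sub hI ((hint _).const_mul t), integral_const_mul] at h1
  have h2 : ∫ y, ψs n y ∂m = ∫ y, ψ y ∂m + t * ∫ y, h y ∂m := by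
    rw [← integral_const_mul]
    exact integral_add (ψ.integrable m) ((k.integrable m).const_mul t)
  have h3 := hψ (ψs n)
  simp only [dualFunctional] at h3
  rw [h2] at h3
  have h4 : t * ∫ x, h (brenierMap Y (ψs n) x) ∂ρ ≤ t * ∫ y, h y ∂m := by linarith
  exact le_of_mul_le_mul_left h4 ht0

theorem map_brenierMap_of_mem_dualMinimizers [Nonempty Y] [IsProbabilityMeasure ρ]
    [IsProbabilityMeasure m] (hX : IsCompact X) (hY : IsCompact Y) (hρ : ρ ≪ vol)
    (hρX : ρ Xᶜ = 0) {ψ : Y →ᵇ ℝ} (hψ : ψ ∈ dualMinimizers ρ m) :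
    ρ.map (brenierMap Y ψ) = m.map Subtype.val := by
  have hm := measurable_brenierMap Y ψ
  have : IsProbabilityMeasure (ρ.map (brenierMap Y ψ)) :=
    Measure.isProbabilityMeasure_map hm.aemeasurable
  have : IsProbabilityMeasure (m.map (Subtype.val : Y → E)) :=
    Measure.isProbabilityMeasure_map measurable_subtype_coe.aemeasurable
  refine ext_of_forall_integral_eq_of_IsFiniteMeasure fun h => ?_
  rw [integral_map hm.aemeasurable h.continuous.aestronglyMeasurable,
    integral_map measurable_subtype_coe.aemeasurable h.continuous.aestronglyMeasurable]
  refine le_antisymm (integral_comp_brenierMap_le hX hY hρ hρX hψ h) ?_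
  -- The opposite inequality is the same one for `-h`.
  have := integral_comp_brenierMap_le hX hY hρ hρX hψ (-h)
  simp only [BoundedContinuousFunction.coe_neg, Pi.neg_apply, integral_neg] at this
  linarith

end Dual

/-! ### Optimality and uniqueness of gradient maps; continuity into `L²` -/

section Optimality

open BoundedContinuousFunction
open scoped RealInnerProductSpace

theorem ae_mem_of_map_compl_null {α E : Type*} [MeasurableSpace α] [MeasurableSpace E]
    [TopologicalSpace E] [T2Space E] [OpensMeasurableSpace E] {ρ : Measure α} {Y : Set E}
    {S : α → E} (hY : IsCompact Y) (hS : AEMeasurable S ρ)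
    (hSY : ρ.map S Yᶜ = 0) : ∀ᵐ x ∂ρ, S x ∈ Y := by
  rw [Measure.map_apply_of_aemeasurable hS hY.isClosed.measurableSet.compl] at hSY
  exact hSY

variable {E : Type*} [NormedAddCommGroup E] [InnerProductSpace ℝ E] [MeasurableSpace E]
  [BorelSpace E] [FiniteDimensional ℝ E]
  {X Y : Set E} {ρ : Measure E} [IsProbabilityMeasure ρ] {S : E → E}

theorem integrable_norm_sub_sq (hX : IsCompact X) (hY : IsCompact Y) (hρX : ρ Xᶜ = 0)
    (hS : AEMeasurable S ρ) (hSY : ρ.map S Yᶜ = 0) :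
    Integrable (fun x => ‖x - S x‖ ^ 2) ρ := by
  obtain ⟨M, hM⟩ := hX.isBounded.exists_norm_le
  obtain ⟨R, hR⟩ := hY.isBounded.exists_norm_le
  refine (integrable_const ((M + R) ^ 2)).mono'
    ((aemeasurable_id.sub hS).norm.pow_const 2).aestronglyMeasurable ?_
  filter_upwards [ae_mem_of_compl_null hρX, ae_mem_of_map_compl_null hY hS hSY] with x hx hSx
  rw [Real.norm_of_nonneg (by positivity)]
  gcongr
  exact (norm_sub_le _ _).trans (add_le_add (hM x hx) (hR _ hSx))

theorem lintegral_enorm_sub_sq (hX : IsCompact X) (hY : IsCompact Y) (hρX : ρ Xᶜ = 0)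
    (hS : AEMeasurable S ρ) (hSY : ρ.map S Yᶜ = 0) :
    ∫⁻ x, ‖x - S x‖ₑ ^ 2 ∂ρ = ENNReal.ofReal (∫ x, ‖x - S x‖ ^ 2 ∂ρ) := by
  rw [ofReal_integral_eq_lintegral_ofReal (integrable_norm_sub_sq hX hY hρX hS hSY)
    (Eventually.of_forall fun x => by positivity)]
  congr with x
  rw [ENNReal.ofReal_pow (norm_nonneg _), ofReal_norm]

/-- The cost of `S` differs from a quantity that depends only on its law by twice the integral of
the slack in the Fenchel–Young inequality at `(x, S x)`. -/
theorem integral_norm_sub_sq_eq [Nonempty Y] (hX : IsCompact X) (hY : IsCompact Y)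
    (hρX : ρ Xᶜ = 0) (ψ : Y →ᵇ ℝ) (f : E →ᵇ ℝ)
    (hS : AEMeasurable S ρ) (hSY : ρ.map S Yᶜ = 0) :
    Integrable (fun x => legendre Y ψ x - ⟪x, S x⟫ + f (S x)) ρ ∧
    ∫ x, ‖x - S x‖ ^ 2 ∂ρ =
      (∫ x, (‖x‖ ^ 2 - 2 * legendre Y ψ x) ∂ρ + ∫ y, (‖y‖ ^ 2 - 2 * f y) ∂(ρ.map S)) +
        2 * ∫ x, (legendre Y ψ x - ⟪x, S x⟫ + f (S x)) ∂ρ := by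
  have hL := continuous_legendre hY ψ
  have hprob : IsProbabilityMeasure (ρ.map S) := Measure.isProbabilityMeasure_map hS
  have h1 : Integrable (fun x => ‖x‖ ^ 2 - 2 * legendre Y ψ x) ρ :=
    integrable_of_continuous_of_compl_null hX hρX (by fun_prop)
  have hc : Continuous fun y : E => ‖y‖ ^ 2 - 2 * f y := by fun_prop
  have h2 : Integrable (fun x => ‖S x‖ ^ 2 - 2 * f (S x)) ρ :=
    (integrable_of_continuous_of_compl_null hY hSY hc).comp_aemeasurable hS
  have h3 := integrable_norm_sub_sq hX hY hρX hS hSY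
  have hid (x : E) : legendre Y ψ x - ⟪x, S x⟫ + f (S x) = (2 : ℝ)⁻¹ *
      (‖x - S x‖ ^ 2 - ((‖x‖ ^ 2 - 2 * legendre Y ψ x) + (‖S x‖ ^ 2 - 2 * f (S x)))) := by
    rw [norm_sub_sq_real]
    ring
  have h4 : Integrable (fun x => legendre Y ψ x - ⟪x, S x⟫ + f (S x)) ρ := by
    simp_rw [hid]
    exact (h3.sub (h1.add h2)).const_mul _
  refine ⟨h4, ?_⟩
  rw [integral_map hS hc.aestronglyMeasurable]
  simp_rw [hid]
  have h5 := integral_sub h3 (h1.add h2)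
  simp only [Pi.add_apply] at h5
  rw [integral_const_mul, h5, integral_add h1 h2]
  ring

variable {vol : Measure E} [vol.IsAddHaarMeasure] [CompleteSpace E]

/-- Maps with the same law have costs differing only through the Fenchel–Young slack, which is
nonnegative and vanishes a.e. for the gradient map. If `S` costs no more, its slack vanishes a.e.
too, so `S x` is a maximizer and hence equals the gradient. -/
theorem brenierMap_optimal [Nonempty Y] (hX : IsCompact X) (hY : IsCompact Y) (hρ : ρ ≪ vol)
    (hρX : ρ Xᶜ = 0) (ψ : Y →ᵇ ℝ) (hTY : ρ.map (brenierMap Y ψ) Yᶜ = 0)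
    (hS : AEMeasurable S ρ) (hmap : ρ.map S = ρ.map (brenierMap Y ψ)) :
    ∫⁻ x, ‖x - brenierMap Y ψ x‖ₑ ^ 2 ∂ρ ≤ ∫⁻ x, ‖x - S x‖ₑ ^ 2 ∂ρ ∧
    (∫⁻ x, ‖x - S x‖ₑ ^ 2 ∂ρ ≤ ∫⁻ x, ‖x - brenierMap Y ψ x‖ₑ ^ 2 ∂ρ →
      S =ᵐ[ρ] brenierMap Y ψ) := by
  have hSY : ρ.map S Yᶜ = 0 := hmap ▸ hTY
  have hT := (measurable_brenierMap Y ψ).aemeasurable (μ := ρ)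
  -- Tietze extension of `ψ` off `Y`, so that it can be composed with `S` and integrated against
  -- laws on the whole space.
  obtain ⟨f, -, hf⟩ := exists_extension_norm_eq_of_isClosedEmbedding ψ
    hY.isClosed.isClosedEmbedding_subtypeVal
  have hf (y : Y) : f y = ψ y := congrFun hf y
  obtain ⟨-, hTeq⟩ := integral_norm_sub_sq_eq hX hY hρX ψ f hT hTY
  obtain ⟨hint, hSeq⟩ := integral_norm_sub_sq_eq hX hY hρX ψ f hS hSY
  have hT0 : ∫ x, (legendre Y ψ x - ⟪x, brenierMap Y ψ x⟫ + f (brenierMap Y ψ x)) ∂ρ = 0 := by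
    refine integral_eq_zero_of_ae ?_
    filter_upwards [ae_differentiableAt_legendre hY hρ ψ] with x hx
    obtain ⟨y, hy, hyx⟩ := exists_brenierMap_eq hY hx
    rw [hy, hf, Pi.zero_apply]
    linarith
  have hnonneg : 0 ≤ᵐ[ρ] fun x => legendre Y ψ x - ⟪x, S x⟫ + f (S x) := by
    filter_upwards [ae_mem_of_map_compl_null hY hS hSY] with x hx
    have := inner_sub_le_legendre hY ψ x ⟨S x, hx⟩
    rw [← hf] at this
    simp only [Pi.zero_apply] at this ⊢
    linarith
  rw [hT0, ← hmap] at hTeq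
  rw [lintegral_enorm_sub_sq hX hY hρX hS hSY, lintegral_enorm_sub_sq hX hY hρX hT hTY]
  have hS0 := integral_nonneg_of_ae hnonneg
  refine ⟨ENNReal.ofReal_le_ofReal (by linarith), fun hle => ?_⟩
  rw [ENNReal.ofReal_le_ofReal_iff (integral_nonneg fun x => by positivity)] at hle
  have hzero := (integral_eq_zero_iff_of_nonneg_ae hnonneg hint).1 (le_antisymm (by linarith) hS0)
  filter_upwards [hzero, ae_differentiableAt_legendre hY hρ ψ,
    ae_mem_of_map_compl_null hY hS hSY] with x hx hd hSx
  refine (brenierMap_eq_of_isMax hY hd ⟨S x, hSx⟩ ?_).symm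
  rw [← hf]
  simp only [Pi.zero_apply] at hx ⊢
  linarith

theorem memLp_brenierMap [Nonempty Y] (hY : IsCompact Y) (ρ : Measure E) [IsProbabilityMeasure ρ]
    (p : ℝ≥0∞) (ψ : Y →ᵇ ℝ) : MemLp (brenierMap Y ψ) p ρ := by
  obtain ⟨R, hR⟩ := hY.isBounded.exists_norm_le
  exact MemLp.of_bound (measurable_brenierMap Y ψ).aestronglyMeasurable R.toNNReal
    (Eventually.of_forall (norm_brenierMap_le hY (R := R.toNNReal)
      (fun y hy => (hR y hy).trans (Real.le_coe_toNNReal R)) ψ))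

/-- Dominated convergence: the gradients converge a.e. along uniformly convergent sequences of
potentials, and are all bounded by the radius of a ball containing `Y`. -/
theorem continuous_toLp_brenierMap [Nonempty Y] (hY : IsCompact Y) (hρ : ρ ≪ vol) :
    Continuous fun ψ : Y →ᵇ ℝ => (memLp_brenierMap hY ρ 2 ψ).toLp (brenierMap Y ψ) := by
  obtain ⟨R, hR⟩ := hY.isBounded.exists_norm_le
  have hR' := fun (χ : Y →ᵇ ℝ) => norm_brenierMap_le hY (R := R.toNNReal)
      (fun y hy => (hR y hy).trans (Real.le_coe_toNNReal R)) χ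
  refine continuous_iff_seqContinuous.2 fun ψs ψ hψ => ?_
  refine (Lp.tendsto_Lp_iff_tendsto_eLpNorm'' (fun n => brenierMap Y (ψs n))
    (fun n => memLp_brenierMap hY ρ 2 (ψs n)) (brenierMap Y ψ) (memLp_brenierMap hY ρ 2 ψ)).2 ?_
  have hlim : Tendsto (fun n => ∫⁻ x, ‖brenierMap Y (ψs n) x - brenierMap Y ψ x‖ₑ ^ (2 : ℝ) ∂ρ)
      atTop (𝓝 (∫⁻ _, 0 ∂ρ)) := by
    refine tendsto_lintegral_of_dominated_convergence
      (fun _ => (2 * (R.toNNReal : ℝ≥0∞)) ^ (2 : ℝ)) (fun n => ?_) (fun n => ?_) ?_ ?_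
    · exact ((measurable_brenierMap Y _).sub (measurable_brenierMap Y _)).enorm.pow_const _
    · refine Eventually.of_forall fun x => ?_
      have hle (χ : Y →ᵇ ℝ) : ‖brenierMap Y χ x‖ₑ ≤ R.toNNReal := by
        rw [enorm_eq_nnnorm, ENNReal.coe_le_coe]
        exact hR' χ x
      refine ENNReal.rpow_le_rpow ?_ (by norm_num)
      exact (enorm_sub_le).trans ((add_le_add (hle _) (hle _)).trans_eq (two_mul _).symm)
    · simp [ENNReal.mul_eq_top]
    · filter_upwards [ae_tendsto_brenierMap hY hρ hψ] with x hx
      have h1 : Tendsto (fun n => ‖brenierMap Y (ψs n) x - brenierMap Y ψ x‖ₑ) atTop (𝓝 0) := by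
        simpa using (hx.sub_const (brenierMap Y ψ x)).enorm
      have h2 := ((ENNReal.continuous_rpow_const (y := 2)).tendsto 0).comp h1
      rwa [ENNReal.zero_rpow_of_pos (by norm_num)] at h2
  have h2 := ((ENNReal.continuous_rpow_const (y := (1 / 2 : ℝ))).tendsto _).comp hlim
  simp only [lintegral_zero, ENNReal.zero_rpow_of_pos (show (0 : ℝ) < 1 / 2 by norm_num)] at h2
  refine h2.congr fun n => ?_
  rw [eLpNorm_eq_lintegral_rpow_enorm_toReal (by norm_num) (by norm_num)]
  simp

end Optimality

/-! ### The Monge embedding: well-posedness and weak continuity -/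

section Embedding

open BoundedContinuousFunction

variable {d : ℕ} {X Y : Set (EuclideanSpace ℝ (Fin d))} {ρ : Measure (EuclideanSpace ℝ (Fin d))}

theorem IsMongeMap.congr {μ : Measure (EuclideanSpace ℝ (Fin d))}
    {T T' : EuclideanSpace ℝ (Fin d) → EuclideanSpace ℝ (Fin d)} (hT : IsMongeMap ρ μ T)
    (h : T =ᵐ[ρ] T') : IsMongeMap ρ μ T' where
  aemeasurable := hT.aemeasurable.congr h
  map_eq := (Measure.map_congr h).symm.trans hT.map_eq
  cost_le S hS hSμ := by
    refine le_of_eq_of_le (lintegral_congr_ae ?_) (hT.cost_le S hS hSμ)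
    filter_upwards [h] with x hx
    rw [hx]

/-- An element of `𝒫(Y)` as a measure on the subtype `Y`. -/
def measOn (μ : probOn Y) : Measure Y := (measOf μ).comap Subtype.val

theorem map_val_measOn (hY : IsCompact Y) (μ : probOn Y) :
    (measOn μ).map Subtype.val = measOf μ := by
  rw [measOn, map_comap_subtype_coe hY.isClosed.measurableSet,
    Measure.restrict_eq_self_of_ae_mem (ae_mem_of_compl_null μ.2)]

theorem isProbabilityMeasure_measOn (hY : IsCompact Y) (μ : probOn Y) :
    IsProbabilityMeasure (measOn μ) := by
  constructor
  have h : measOf μ univ = 1 := measure_univ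
  rwa [← map_val_measOn hY μ, Measure.map_apply measurable_subtype_coe .univ, preimage_univ] at h

theorem nonempty_of_probOn (μ : probOn Y) : Nonempty Y := by
  obtain ⟨y, hy⟩ := (ae_mem_of_compl_null μ.2).exists
  exact ⟨⟨y, hy⟩⟩

theorem continuous_integral_measOn (hY : IsCompact Y) (ψ : Y →ᵇ ℝ) :
    Continuous fun μ : probOn Y => ∫ y, ψ y ∂(measOn μ) := by
  obtain ⟨f, -, hf⟩ := exists_extension_norm_eq_of_isClosedEmbedding ψ
    hY.isClosed.isClosedEmbedding_subtypeVal
  have h (μ : probOn Y) : ∫ y, ψ y ∂(measOn μ) = ∫ y, f y ∂(measOf μ) := by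
    rw [← map_val_measOn hY μ, integral_map measurable_subtype_coe.aemeasurable
      f.continuous.aestronglyMeasurable, ← hf]
    rfl
  simp_rw [h]
  exact (ProbabilityMeasure.continuous_integral_boundedContinuousFunction f).comp
    continuous_subtype_val

/-- Continuity in `μ` for each `ψ` upgrades to joint continuity because the Lipschitz constant in
`ψ` is uniform in `μ`. -/
theorem continuous_dualFunctional [IsProbabilityMeasure ρ] [Nonempty Y] (hX : IsCompact X)
    (hY : IsCompact Y) (hρX : ρ Xᶜ = 0) :
    Continuous fun p : (Y →ᵇ ℝ) × probOn Y => dualFunctional ρ (measOn p.2) p.1 := by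
  refine continuous_prod_of_continuous_lipschitzWith _ 2 (fun ψ => ?_) fun μ => ?_
  · have := (continuous_integral_measOn hY ψ).const_add (∫ x, legendre Y ψ x ∂ρ)
    exact this
  · have := isProbabilityMeasure_measOn hY μ
    exact dualFunctional_lipschitzWith (m := measOn μ) hX hY hρX

variable [IsProbabilityMeasure ρ]

theorem isMongeMap_brenierMap [Nonempty Y] (hX : IsCompact X) (hY : IsCompact Y)
    (hρ : ρ ≪ volume) (hρX : ρ Xᶜ = 0) {μ : probOn Y} {ψ : Y →ᵇ ℝ}
    (hψ : ψ ∈ dualMinimizers ρ (measOn μ)) :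
    IsMongeMap ρ (measOf μ) (brenierMap Y ψ) ∧
      ∀ S, IsMongeMap ρ (measOf μ) S → S =ᵐ[ρ] brenierMap Y ψ := by
  have := isProbabilityMeasure_measOn hY μ
  have hmap : ρ.map (brenierMap Y ψ) = measOf μ := by
    rw [map_brenierMap_of_mem_dualMinimizers hX hY hρ hρX hψ, map_val_measOn hY]
  have hTY : ρ.map (brenierMap Y ψ) Yᶜ = 0 := by rw [hmap]; exact μ.2
  have hT := (measurable_brenierMap Y ψ).aemeasurable (μ := ρ)
  refine ⟨⟨hT, hmap, fun S hS hSμ => ?_⟩, fun S hS => ?_⟩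
  · exact (brenierMap_optimal hX hY hρ hρX ψ hTY hS (hSμ.trans hmap.symm)).1
  · exact (brenierMap_optimal hX hY hρ hρX ψ hTY hS.aemeasurable
      (hS.map_eq.trans hmap.symm)).2 (hS.cost_le _ hT hmap)

/-- Every minimizer represents the embedding, so dual potentials need not be unique. -/
theorem mongeEmbedding_eq_toLp [Nonempty Y] (hX : IsCompact X) (hY : IsCompact Y)
    (hρ : ρ ≪ volume) (hρX : ρ Xᶜ = 0) {μ : probOn Y} {ψ : Y →ᵇ ℝ}
    (hψ : ψ ∈ dualMinimizers ρ (measOn μ)) :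
    mongeEmbedding ρ μ = (memLp_brenierMap hY ρ 2 ψ).toLp (brenierMap Y ψ) := by
  obtain ⟨hT, huniq⟩ := isMongeMap_brenierMap hX hY hρ hρX hψ
  have hex : ∃ T : Lp (EuclideanSpace ℝ (Fin d)) 2 ρ, IsMongeMap ρ (measOf μ) T :=
    ⟨_, hT.congr (memLp_brenierMap hY ρ 2 ψ).coeFn_toLp.symm⟩
  rw [mongeEmbedding, dif_pos hex]
  exact Lp.ext ((huniq _ hex.choose_spec).trans (memLp_brenierMap hY ρ 2 ψ).coeFn_toLp.symm)

theorem exists_nnreal_norm_le (hX : IsCompact X) : ∃ M : ℝ≥0, ∀ x ∈ X, ‖x‖ ≤ M := by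
  obtain ⟨M, hM⟩ := hX.isBounded.exists_norm_le
  exact ⟨M.toNNReal, fun x hx => (hM x hx).trans (Real.le_coe_toNNReal M)⟩

theorem mongeEmbedding_spec (hX : IsCompact X) (hY : IsCompact Y)
    (hρ : ρ ≪ volume) (hρX : ρ Xᶜ = 0) (μ : probOn Y) :
    IsMongeMap ρ (measOf μ) (mongeEmbedding ρ μ) ∧
      ∀ T : EuclideanSpace ℝ (Fin d) → EuclideanSpace ℝ (Fin d),
        IsMongeMap ρ (measOf μ) T → T =ᵐ[ρ] mongeEmbedding ρ μ := by
  have hne := nonempty_of_probOn μ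
  have := isProbabilityMeasure_measOn hY μ
  obtain ⟨M, hM⟩ := exists_nnreal_norm_le hX
  obtain ⟨ψ, -, hψ⟩ :=
    exists_normalized_dualMinimizer (m := measOn μ) hX hY hρX hM (Classical.arbitrary Y)
  obtain ⟨hT, huniq⟩ := isMongeMap_brenierMap hX hY hρ hρX hψ
  have hae := (memLp_brenierMap hY ρ 2 ψ).coeFn_toLp.symm
  rw [mongeEmbedding_eq_toLp hX hY hρ hρX hψ]
  exact ⟨hT.congr hae, fun T h => (huniq T h).trans hae⟩

theorem continuous_mongeEmbedding (hX : IsCompact X) (hY : IsCompact Y)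
    (hρ : ρ ≪ volume) (hρX : ρ Xᶜ = 0) :
    Continuous fun μ : probOn Y => mongeEmbedding ρ μ := by
  rcases isEmpty_or_nonempty Y with hemp | hne
  · exact continuous_iff_continuousAt.2 fun μ =>
      (not_nonempty_iff.2 hemp (nonempty_of_probOn μ)).elim
  obtain ⟨M, hM⟩ := exists_nnreal_norm_le hX
  let K := normalizedPotentials Y M (Classical.arbitrary Y)
  have : CompactSpace K := isCompact_iff_compactSpace.1 (isCompact_normalizedPotentials hY M _)
  refine continuous_iff_isClosed.2 fun C hC => ?_
  -- Pairs of a measure and a normalized minimizing potential whose gradient lies in `C`. The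
  -- preimage of `C` under the embedding is the projection of this closed set along the compact
  -- factor `K`, hence closed.
  let Γ : Set (probOn Y × K) :=
    (⋂ ψ' : Y →ᵇ ℝ, {p | dualFunctional ρ (measOn p.1) p.2 ≤ dualFunctional ρ (measOn p.1) ψ'}) ∩
      {p | (memLp_brenierMap hY ρ 2 (p.2 : Y →ᵇ ℝ)).toLp (brenierMap Y p.2) ∈ C}
  have hJ := continuous_dualFunctional hX hY hρX
  have hΓ : IsClosed Γ := by
    refine (isClosed_iInter fun ψ' => isClosed_le ?_ ?_).inter ?_
    · exact hJ.comp ((continuous_subtype_val.comp continuous_snd).prodMk continuous_fst)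
    · exact hJ.comp (continuous_const.prodMk continuous_fst)
    · exact hC.preimage ((continuous_toLp_brenierMap hY hρ).comp
        (continuous_subtype_val.comp continuous_snd))
  convert isClosedMap_fst_of_compactSpace Γ hΓ using 1
  ext μ
  constructor
  · intro hμ
    have := isProbabilityMeasure_measOn hY μ
    obtain ⟨ψ, hψK, hψ⟩ :=
      exists_normalized_dualMinimizer (m := measOn μ) hX hY hρX hM (Classical.arbitrary Y)
    refine ⟨(μ, ⟨ψ, hψK⟩), ⟨mem_iInter.2 hψ, ?_⟩, rfl⟩
    rwa [mem_preimage, mongeEmbedding_eq_toLp hX hY hρ hρX hψ] at hμ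
  · rintro ⟨⟨μ, ψ⟩, ⟨hmin, hC⟩, rfl⟩
    rw [mem_preimage, mongeEmbedding_eq_toLp hX hY hρ hρX (mem_iInter.1 hmin)]
    exact hC

end Embedding

/-! ### Wasserstein distance: comparison with weak convergence and with `L²` -/

section Wasserstein

variable {d : ℕ} {Y : Set (EuclideanSpace ℝ (Fin d))}

/-- The easy half of Kantorovich–Rubinstein duality: the difference of integrals is `∫ (f z.1 - f
z.2) dγ` for any plan `γ`, bounded by `L` times the first moment, which is at most the `p`-th one
since `γ` is a probability. -/
theorem enorm_integral_sub_le_wasserstein {p : ℝ} (hp : 1 ≤ p) {L : ℝ≥0}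
    {f : EuclideanSpace ℝ (Fin d) → ℝ} (hf : LipschitzWith L f) {C : ℝ}
    (hC : ∀ x, ‖f x‖ ≤ C) (hL : L ≠ 0) (μ ν : probOn Y) :
    ‖∫ x, f x ∂(measOf μ) - ∫ x, f x ∂(measOf ν)‖ₑ ≤ L * wasserstein p μ ν := by
  have hp0 : 0 < p := by linarith
  rw [← ENNReal.div_le_iff' (by simpa using hL) ENNReal.coe_ne_top, wasserstein, one_div,
    ENNReal.le_rpow_inv_iff hp0]
  refine le_iInf₂ fun γ hγ => ?_
  obtain ⟨h1, h2⟩ := hγ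
  have hprob : IsProbabilityMeasure γ := by
    constructor
    have h : measOf μ univ = 1 := measure_univ
    rwa [← h1, Measure.map_apply measurable_fst .univ, preimage_univ] at h
  rw [← ENNReal.le_rpow_inv_iff hp0, ENNReal.div_le_iff' (by simpa using hL)
    ENNReal.coe_ne_top]
  have hint {m : Measure (EuclideanSpace ℝ (Fin d))} [IsFiniteMeasure m] : Integrable f m :=
    (integrable_const C).mono' hf.continuous.aestronglyMeasurable (Eventually.of_forall hC)
  have i1 : Integrable (fun z => f z.1) γ := by
    have := hint (m := measOf μ)
    rw [← h1] at this
    exact this.comp_measurable measurable_fst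
  have i2 : Integrable (fun z => f z.2) γ := by
    have := hint (m := measOf ν)
    rw [← h2] at this
    exact this.comp_measurable measurable_snd
  have heq : ∫ x, f x ∂(measOf μ) - ∫ x, f x ∂(measOf ν) = ∫ z, (f z.1 - f z.2) ∂γ := by
    rw [integral_sub i1 i2, ← h1, ← h2,
      integral_map measurable_fst.aemeasurable hf.continuous.aestronglyMeasurable,
      integral_map measurable_snd.aemeasurable hf.continuous.aestronglyMeasurable]
  have hmeas : AEStronglyMeasurable
      (fun z : EuclideanSpace ℝ (Fin d) × EuclideanSpace ℝ (Fin d) => z.1 - z.2) γ :=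
    (measurable_fst.sub measurable_snd).aestronglyMeasurable
  calc ‖∫ x, f x ∂(measOf μ) - ∫ x, f x ∂(measOf ν)‖ₑ
      ≤ ∫⁻ z, ‖f z.1 - f z.2‖ₑ ∂γ := heq ▸ enorm_integral_le_lintegral_enorm _
    _ ≤ ∫⁻ z, L * ‖z.1 - z.2‖ₑ ∂γ := by
        refine lintegral_mono fun z => ?_
        rw [← edist_eq_enorm_sub, ← edist_eq_enorm_sub]
        exact hf z.1 z.2
    _ = L * ∫⁻ z, ‖z.1 - z.2‖ₑ ∂γ := lintegral_const_mul' _ _ ENNReal.coe_ne_top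
    _ ≤ L * (∫⁻ z, ‖z.1 - z.2‖ₑ ^ p ∂γ) ^ p⁻¹ := by
        gcongr
        have := eLpNorm'_le_eLpNorm'_of_exponent_le (p := 1) (q := p) zero_lt_one hp γ hmeas
        simpa [eLpNorm'] using this

theorem tendsto_of_wasserstein {p : ℝ} (hp : 1 ≤ p) (μ : probOn Y) :
    Tendsto id (comap (fun ν => wasserstein p μ ν) (𝓝 0)) (𝓝 μ) := by
  rw [tendsto_subtype_rng, tendsto_iff_forall_lipschitz_integral_tendsto]
  rintro f ⟨C, hC⟩ ⟨L, hL⟩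
  have hbound (x : EuclideanSpace ℝ (Fin d)) : ‖f x‖ ≤ C + ‖f 0‖ := by
    have h1 := hC x 0
    have h2 := norm_sub_norm_le (f x) (f 0)
    rw [dist_eq_norm] at h1
    linarith
  -- The constant is raised so as to be nonzero, as dividing by it requires.
  have hL' : LipschitzWith (L + 1) f := hL.weaken (by simp)
  rw [tendsto_iff_edist_tendsto_0]
  have hlim : Tendsto (fun ν => ((L + 1 : ℝ≥0) : ℝ≥0∞) * wasserstein p μ ν)
      (comap (fun ν => wasserstein p μ ν) (𝓝 0)) (𝓝 0) := by
    have h := ENNReal.Tendsto.const_mul (a := ((L + 1 : ℝ≥0) : ℝ≥0∞))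
      (tendsto_comap (f := fun ν => wasserstein p μ ν) (x := 𝓝 0)) (.inr ENNReal.coe_ne_top)
    rwa [mul_zero] at h
  refine tendsto_of_tendsto_of_tendsto_of_le_of_le tendsto_const_nhds hlim (fun _ => zero_le)
    fun ν => ?_
  rw [edist_comm, edist_eq_enorm_sub]
  exact enorm_integral_sub_le_wasserstein hp hL' hbound (by simp) μ ν

theorem exists_wasserstein_lt_of_continuous {F : Type*} [NormedAddCommGroup F]
    {g : probOn Y → F} (hg : Continuous g) {p : ℝ} (hp : 1 ≤ p) (μ : probOn Y) {ε : ℝ≥0∞}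
    (hε : 0 < ε) :
    ∃ δ : ℝ≥0∞, 0 < δ ∧ ∀ ν : probOn Y, wasserstein p μ ν < δ → ‖g μ - g ν‖ₑ < ε := by
  have h := (hg.tendsto μ).comp (tendsto_of_wasserstein hp μ)
  have h2 := h.eventually (Metric.eball_mem_nhds (g μ) hε)
  rw [eventually_comap] at h2
  obtain ⟨δ, hδ, hball⟩ := ENNReal.nhds_zero_basis.eventually_iff.1 h2
  refine ⟨δ, hδ, fun ν hν => ?_⟩
  have := hball hν ν rfl
  rwa [edist_comm, edist_eq_enorm_sub] at this

/-- The law of `(S, T)` under `ρ` is a plan whose quadratic cost is `‖S - T‖²`. -/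
theorem wasserstein_two_le_of_map (ρ : Measure (EuclideanSpace ℝ (Fin d)))
    {μ ν : probOn Y} (S T : Lp (EuclideanSpace ℝ (Fin d)) 2 ρ)
    (hS : ρ.map S = measOf μ) (hT : ρ.map T = measOf ν) :
    wasserstein 2 μ ν ≤ ‖S - T‖ₑ := by
  have mS := (Lp.aestronglyMeasurable S).aemeasurable
  have mT := (Lp.aestronglyMeasurable T).aemeasurable
  have hγ : ρ.map (fun x => (S x, T x)) ∈ transportPlans (measOf μ) (measOf ν) := by
    constructor
    · rw [AEMeasurable.map_map_of_aemeasurable measurable_fst.aemeasurable (mS.prodMk mT), ← hS]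
      rfl
    · rw [AEMeasurable.map_map_of_aemeasurable measurable_snd.aemeasurable (mS.prodMk mT), ← hT]
      rfl
  rw [Lp.enorm_def, eLpNorm_congr_ae (Lp.coeFn_sub S T),
    eLpNorm_eq_lintegral_rpow_enorm_toReal (by norm_num) (by norm_num), wasserstein]
  simp only [ENNReal.toReal_ofNat]
  refine ENNReal.rpow_le_rpow ((iInf₂_le _ hγ).trans_eq ?_) (by norm_num)
  rw [lintegral_map' (by fun_prop) (mS.prodMk mT)]
  rfl

end Wasserstein

/-! ### Antipodal Dirac pairs on the disc -/

section Disc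

open scoped RealInnerProductSpace

theorem measurableSet_unitDisc : MeasurableSet unitDisc :=
  Metric.isClosed_closedBall.measurableSet

instance isProbabilityMeasure_uniformDisc : IsProbabilityMeasure uniformDisc := by
  constructor
  rw [uniformDisc, Measure.smul_apply, Measure.restrict_apply_univ, smul_eq_mul]
  exact ENNReal.inv_mul_cancel (Metric.measure_closedBall_pos _ _ one_pos).ne'
    measure_closedBall_lt_top.ne

theorem uniformDisc_absolutelyContinuous : uniformDisc ≪ volume :=
  (Measure.absolutelyContinuous_of_le Measure.restrict_le_self).smul_left _

theorem uniformDisc_compl : uniformDisc unitDiscᶜ = 0 := by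
  rw [uniformDisc, Measure.smul_apply,
    Measure.restrict_apply measurableSet_unitDisc.compl]
  simp

theorem map_neg_uniformDisc : uniformDisc.map (fun x => -x) = uniformDisc := by
  have h : Measure.map (fun x => -x) (volume.restrict unitDisc) = volume.restrict unitDisc := by
    have h1 := (Measure.measurePreserving_neg (volume : Measure (EuclideanSpace ℝ (Fin 2))))
      |>.restrict_preimage measurableSet_unitDisc
    have h2 : (Neg.neg : EuclideanSpace ℝ (Fin 2) → _) ⁻¹' unitDisc = unitDisc := by
      ext x
      simp [unitDisc]
    rw [h2] at h1
    exact h1.map_eq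
  rw [uniformDisc, Measure.map_smul, h]

/-- The point of `{v, -v}` that is nearest to `x`. -/
def nearestAntipodal {E : Type*} [NormedAddCommGroup E] [InnerProductSpace ℝ E] (v x : E) : E :=
  open Classical in if 0 ≤ ⟪x, v⟫ then v else -v

section Nearest

variable {E : Type*} [NormedAddCommGroup E] [InnerProductSpace ℝ E]

theorem norm_sub_nearestAntipodal_le {v x w : E} (hw : w = v ∨ w = -v) :
    ‖x - nearestAntipodal v x‖ ≤ ‖x - w‖ := by
  have h1 := norm_sub_sq_real x v
  have h2 := norm_sub_sq_real x (-v)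
  rw [inner_neg_right, norm_neg] at h2
  have h3 : ‖x - nearestAntipodal v x‖ ^ 2 ≤ ‖x - w‖ ^ 2 := by
    unfold nearestAntipodal
    split_ifs with h <;> rcases hw with rfl | rfl <;> linarith
  exact (pow_le_pow_iff_left₀ (norm_nonneg _) (norm_nonneg _) two_ne_zero).1 h3

theorem measurable_nearestAntipodal [MeasurableSpace E] [BorelSpace E] (v : E) :
    Measurable (nearestAntipodal v) := by
  classical
  have h : MeasurableSet {x : E | 0 ≤ ⟪x, v⟫} :=
    (isClosed_le continuous_const (by fun_prop)).measurableSet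
  exact measurable_const.ite h measurable_const

end Nearest

theorem uniformDisc_inner_eq_zero {v : EuclideanSpace ℝ (Fin 2)} (hv : v ≠ 0) :
    uniformDisc {x | ⟪x, v⟫ = 0} = 0 := by
  refine uniformDisc_absolutelyContinuous ?_
  have h : {x | ⟪x, v⟫ = 0} = (((ℝ ∙ v)ᗮ : Submodule ℝ (EuclideanSpace ℝ (Fin 2))) : Set _) := by
    ext x
    rw [mem_ofPred_eq, SetLike.mem_coe, Submodule.mem_orthogonal_singleton_iff_inner_left]
  rw [h]
  refine Measure.addHaar_submodule _ _ fun htop => ?_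
  rw [Submodule.orthogonal_eq_top_iff, Submodule.span_singleton_eq_bot] at htop
  exact hv htop

/-- The two open half-discs are exchanged by `x ↦ -x`, which preserves the measure, and the line
between them is null. -/
theorem uniformDisc_inner_nonneg {v : EuclideanSpace ℝ (Fin 2)} (hv : v ≠ 0) :
    uniformDisc {x | 0 ≤ ⟪x, v⟫} = 2⁻¹ ∧ uniformDisc {x | 0 ≤ ⟪x, v⟫}ᶜ = 2⁻¹ := by
  have hpos : MeasurableSet {x : EuclideanSpace ℝ (Fin 2) | 0 < ⟪x, v⟫} :=
    (isOpen_lt continuous_const (by fun_prop)).measurableSet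
  have hnn : MeasurableSet {x : EuclideanSpace ℝ (Fin 2) | 0 ≤ ⟪x, v⟫} :=
    (isClosed_le continuous_const (by fun_prop)).measurableSet
  have h1 : uniformDisc {x | 0 ≤ ⟪x, v⟫} = uniformDisc {x | 0 < ⟪x, v⟫} := by
    refine measure_congr ?_
    have h0 : ∀ᵐ x ∂uniformDisc, ⟪x, v⟫ ≠ 0 := by
      rw [ae_iff]
      simpa using uniformDisc_inner_eq_zero hv
    filter_upwards [h0] with x hx
    exact propext ⟨fun h => lt_of_le_of_ne h hx.symm, fun h => le_of_lt h⟩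
  have h2 : uniformDisc {x | 0 < ⟪x, v⟫} = uniformDisc {x | 0 ≤ ⟪x, v⟫}ᶜ := by
    nth_rw 1 [← map_neg_uniformDisc]
    rw [Measure.map_apply measurable_neg hpos]
    congr 1
    ext x
    simp
  have h3 := prob_add_prob_compl (μ := uniformDisc) hnn
  rw [← h2, ← h1, ← two_mul] at h3
  rw [← h2, ← h1, and_self]
  exact ENNReal.eq_inv_of_mul_eq_one_left (by rwa [mul_comm])

theorem map_nearestAntipodal {v : EuclideanSpace ℝ (Fin 2)} (hv : v ≠ 0) :
    uniformDisc.map (nearestAntipodal v) =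
      (2⁻¹ : ℝ≥0∞) • (Measure.dirac v + Measure.dirac (-v)) := by
  have hnn : MeasurableSet {x : EuclideanSpace ℝ (Fin 2) | 0 ≤ ⟪x, v⟫} :=
    (isClosed_le continuous_const (by fun_prop)).measurableSet
  rw [← Measure.restrict_add_restrict_compl (μ := uniformDisc) hnn,
    Measure.map_add _ _ (measurable_nearestAntipodal v), smul_add]
  congr 1
  · have h : nearestAntipodal v =ᵐ[uniformDisc.restrict {x | 0 ≤ ⟪x, v⟫}] fun _ => v := by
      filter_upwards [ae_restrict_mem hnn] with x hx using if_pos hx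
    rw [Measure.map_congr h, Measure.map_const, Measure.restrict_apply_univ,
      (uniformDisc_inner_nonneg hv).1]
  · have h : nearestAntipodal v =ᵐ[uniformDisc.restrict {x | 0 ≤ ⟪x, v⟫}ᶜ] fun _ => -v := by
      filter_upwards [ae_restrict_mem hnn.compl] with x hx using if_neg hx
    rw [Measure.map_congr h, Measure.map_const, Measure.restrict_apply_univ,
      (uniformDisc_inner_nonneg hv).2]

theorem circlePoint_ne_zero (θ : ℝ) : circlePoint θ ≠ 0 := by
  rw [← norm_ne_zero_iff, norm_circlePoint]
  exact one_ne_zero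

/-- Any competitor takes values in the pair a.e., so choosing the nearer point is optimal already
pointwise. -/
theorem isMongeMap_nearestAntipodal (θ : ℝ) :
    IsMongeMap uniformDisc (measOf (antipodalDiracs θ)) (nearestAntipodal (circlePoint θ)) where
  aemeasurable := (measurable_nearestAntipodal _).aemeasurable
  map_eq := map_nearestAntipodal (circlePoint_ne_zero θ)
  cost_le S hS hmap := by
    have hfin : MeasurableSet ({circlePoint θ, -circlePoint θ} : Set (EuclideanSpace ℝ (Fin 2))) :=
      (toFinite _).measurableSet
    have h0 : measOf (antipodalDiracs θ) {circlePoint θ, -circlePoint θ}ᶜ = 0 := by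
      show ((2⁻¹ : ℝ≥0∞) • (Measure.dirac (circlePoint θ) + Measure.dirac (-circlePoint θ)))
        {circlePoint θ, -circlePoint θ}ᶜ = 0
      simp [Measure.dirac_apply' _ hfin.compl]
    have hS' : ∀ᵐ x ∂uniformDisc, S x = circlePoint θ ∨ S x = -circlePoint θ := by
      have := ae_mem_of_map_compl_null (toFinite _).isCompact hS (hmap ▸ h0)
      filter_upwards [this] with x hx using hx
    refine lintegral_mono_ae ?_
    filter_upwards [hS'] with x hx
    gcongr
    rw [enorm_le_iff_norm_le]
    exact norm_sub_nearestAntipodal_le hx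

theorem mongeEmbedding_antipodalDiracs (θ : ℝ) :
    mongeEmbedding uniformDisc (antipodalDiracs θ) =ᵐ[uniformDisc]
      nearestAntipodal (circlePoint θ) :=
  ((mongeEmbedding_spec (isCompact_closedBall _ _) (isCompact_closedBall _ _)
    uniformDisc_absolutelyContinuous uniformDisc_compl (antipodalDiracs θ)).2 _
      (isMongeMap_nearestAntipodal θ)).symm

theorem enorm_mongeEmbedding_antipodalDiracs_sub (θ φ : ℝ) :
    ‖mongeEmbedding uniformDisc (antipodalDiracs θ) -
      mongeEmbedding uniformDisc (antipodalDiracs φ)‖ₑ =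
    (∫⁻ x, ‖nearestAntipodal (circlePoint θ) x - nearestAntipodal (circlePoint φ) x‖ₑ ^ (2 : ℝ)
      ∂uniformDisc) ^ (1 / 2 : ℝ) := by
  rw [Lp.enorm_def, eLpNorm_congr_ae ((Lp.coeFn_sub _ _).trans
    ((mongeEmbedding_antipodalDiracs θ).sub (mongeEmbedding_antipodalDiracs φ))),
    eLpNorm_eq_lintegral_rpow_enorm_toReal (by norm_num) (by norm_num)]
  simp

theorem inner_circlePoint (x : EuclideanSpace ℝ (Fin 2)) (θ : ℝ) :
    ⟪x, circlePoint θ⟫ = x 0 * Real.cos θ + x 1 * Real.sin θ := by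
  simp [circlePoint, PiLp.inner_apply, Fin.sum_univ_two, mul_comm]

theorem circlePoint_inner_circlePoint_zero (θ : ℝ) :
    ⟪circlePoint θ, circlePoint 0⟫ = Real.cos θ := by
  rw [inner_circlePoint]
  simp [circlePoint]

/-- The open rectangle `(0, h) × (a, b)`. -/
def openRectangle (h a b : ℝ) : Set (EuclideanSpace ℝ (Fin 2)) :=
  {x | x 0 ∈ Ioo 0 h ∧ x 1 ∈ Ioo a b}

theorem volume_openRectangle (h a b : ℝ) :
    volume (openRectangle h a b) = ENNReal.ofReal h * ENNReal.ofReal (b - a) := by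
  have hpre : openRectangle h a b = WithLp.ofLp ⁻¹'
      (univ.pi fun i : Fin 2 => Ioo ((![0, a] : Fin 2 → ℝ) i) ((![h, b] : Fin 2 → ℝ) i)) := by
    ext x
    simp [openRectangle, Fin.forall_fin_two]
  rw [hpre, (PiLp.volume_preserving_ofLp (Fin 2)).measure_preimage
    (MeasurableSet.univ_pi fun _ => measurableSet_Ioo).nullMeasurableSet, Real.volume_pi_Ioo]
  simp [Fin.prod_univ_two]

theorem measurableSet_openRectangle (h a b : ℝ) : MeasurableSet (openRectangle h a b) := by
  have : IsOpen (openRectangle h a b) :=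
    (isOpen_Ioo.preimage (by fun_prop)).inter (isOpen_Ioo.preimage (by fun_prop))
  exact this.measurableSet

/-- In both cases the two chosen unit vectors have inner product `-|cos θ| ≤ 0`, and their squared
distance is two minus twice that. -/
theorem two_le_norm_sub_nearestAntipodal_sq {θ : ℝ} {x : EuclideanSpace ℝ (Fin 2)}
    (h0 : 0 < x 0) (h : Real.cos θ < 0 ∧ 0 ≤ x 0 * Real.cos θ + x 1 * Real.sin θ ∨
      0 ≤ Real.cos θ ∧ x 0 * Real.cos θ + x 1 * Real.sin θ < 0) :
    2 ≤ ‖nearestAntipodal (circlePoint θ) x - nearestAntipodal (circlePoint 0) x‖ ^ 2 := by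
  have hx0 : 0 ≤ ⟪x, circlePoint 0⟫ := by
    rw [inner_circlePoint]
    simpa using h0.le
  simp only [nearestAntipodal, if_pos hx0]
  rw [norm_sub_sq_real]
  rcases h with ⟨hc, h⟩ | ⟨hc, h⟩ <;> rw [← inner_circlePoint] at h
  · rw [if_pos h, norm_circlePoint, norm_circlePoint, circlePoint_inner_circlePoint_zero]
    linarith
  · rw [if_neg (not_le.2 h), norm_neg, inner_neg_left, norm_circlePoint, norm_circlePoint,
      circlePoint_inner_circlePoint_zero]
    linarith

/-- For `|x 1| ≥ 1/2` and `0 < x 0 < |sin θ| / 2`, the term `x 1 * sin θ` dominates `x 0 * cos θ`.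
The sign of `x 1` is chosen so that the inner product with `circlePoint θ` has the sign opposite to
`cos θ`. The bound `4/5` keeps the rectangle in the disc: `(1/2)² + (4/5)² < 1`. -/
theorem exists_openRectangle_subset (θ : ℝ) :
    ∃ a b : ℝ, b - a = 3 / 10 ∧ ∀ x ∈ openRectangle (|Real.sin θ| / 2) a b, x ∈ unitDisc ∧
      2 ≤ ‖nearestAntipodal (circlePoint θ) x - nearestAntipodal (circlePoint 0) x‖ ^ 2 := by
  have hs := Real.abs_sin_le_one θ
  have hc := abs_le.1 (Real.abs_cos_le_one θ)
  have hdisc (x : EuclideanSpace ℝ (Fin 2)) (h0 : x 0 ∈ Ioo 0 (|Real.sin θ| / 2))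
      (h1 : |x 1| ≤ 4 / 5) : x ∈ unitDisc := by
    rw [unitDisc, mem_closedBall_zero_iff, EuclideanSpace.norm_eq, Real.sqrt_le_one]
    have h2 : x 1 ^ 2 ≤ (4 / 5) ^ 2 := sq_le_sq' (by linarith [abs_le.1 h1]) (abs_le.1 h1).2
    have h3 : x 0 ^ 2 ≤ (1 / 2) ^ 2 := by
      have := h0.1
      have := h0.2
      gcongr
      linarith
    simp only [Fin.sum_univ_two, Real.norm_eq_abs, sq_abs]
    linarith
  have hprod (x : EuclideanSpace ℝ (Fin 2)) (h0 : x 0 ∈ Ioo 0 (|Real.sin θ| / 2)) :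
      |x 0 * Real.cos θ| < |Real.sin θ| / 2 := by
    rw [abs_mul, abs_of_pos h0.1]
    exact (mul_le_of_le_one_right h0.1.le (Real.abs_cos_le_one θ)).trans_lt h0.2
  rcases lt_or_ge (Real.cos θ) 0 with hcos | hcos <;>
    rcases le_total 0 (Real.sin θ) with hsin | hsin
  · refine ⟨1 / 2, 4 / 5, by norm_num, fun x hx => ⟨hdisc x hx.1 ?_, ?_⟩⟩
    · exact abs_le.2 ⟨by linarith [hx.2.1], hx.2.2.le⟩
    · have h := abs_lt.1 (hprod x hx.1)
      rw [abs_of_nonneg hsin] at h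
      refine two_le_norm_sub_nearestAntipodal_sq hx.1.1 (.inl ⟨hcos, ?_⟩)
      nlinarith [hx.2.1]
  · refine ⟨-(4 / 5), -(1 / 2), by norm_num, fun x hx => ⟨hdisc x hx.1 ?_, ?_⟩⟩
    · exact abs_le.2 ⟨hx.2.1.le, by linarith [hx.2.2]⟩
    · have h := abs_lt.1 (hprod x hx.1)
      rw [abs_of_nonpos hsin] at h
      refine two_le_norm_sub_nearestAntipodal_sq hx.1.1 (.inl ⟨hcos, ?_⟩)
      nlinarith [hx.2.2]
  · refine ⟨-(4 / 5), -(1 / 2), by norm_num, fun x hx => ⟨hdisc x hx.1 ?_, ?_⟩⟩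
    · exact abs_le.2 ⟨hx.2.1.le, by linarith [hx.2.2]⟩
    · have h := abs_lt.1 (hprod x hx.1)
      rw [abs_of_nonneg hsin] at h
      refine two_le_norm_sub_nearestAntipodal_sq hx.1.1 (.inr ⟨hcos, ?_⟩)
      nlinarith [hx.2.2]
  · refine ⟨1 / 2, 4 / 5, by norm_num, fun x hx => ⟨hdisc x hx.1 ?_, ?_⟩⟩
    · exact abs_le.2 ⟨by linarith [hx.2.1], hx.2.2.le⟩
    · have h := abs_lt.1 (hprod x hx.1)
      rw [abs_of_nonpos hsin] at h
      refine two_le_norm_sub_nearestAntipodal_sq hx.1.1 (.inr ⟨hcos, ?_⟩)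
      nlinarith [hx.2.1]

theorem exists_le_enorm_mongeEmbedding_antipodalDiracs_sub :
    ∃ κ : ℝ≥0, 0 < κ ∧ ∀ θ : ℝ, (κ : ℝ≥0∞) * ‖Real.sin θ‖ₑ ^ (1 / 2 : ℝ) ≤
      ‖mongeEmbedding uniformDisc (antipodalDiracs θ) -
        mongeEmbedding uniformDisc (antipodalDiracs 0)‖ₑ := by
  have hV0 : volume unitDisc ≠ 0 := (Metric.measure_closedBall_pos _ _ one_pos).ne'
  have hVtop : volume unitDisc ≠ ∞ := measure_closedBall_lt_top.ne
  -- The rectangle has area `|sin θ| / 2 * (3 / 10)` and the squared difference is at least `2` on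
  -- it; the factors `2` cancel.
  let c : ℝ≥0∞ := (volume unitDisc)⁻¹ * ENNReal.ofReal (3 / 10)
  have hctop : c ≠ ∞ := ENNReal.mul_ne_top (ENNReal.inv_ne_top.2 hV0) ENNReal.ofReal_ne_top
  have hc0 : c ≠ 0 := mul_ne_zero (ENNReal.inv_ne_zero.2 hVtop)
    (by rw [ne_eq, ENNReal.ofReal_eq_zero]; norm_num)
  have hκ : c ^ (1 / 2 : ℝ) ≠ ∞ := ENNReal.rpow_ne_top_of_nonneg (by norm_num) hctop
  refine ⟨(c ^ (1 / 2 : ℝ)).toNNReal, ENNReal.toNNReal_pos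
    (ENNReal.rpow_pos (pos_iff_ne_zero.2 hc0) hctop).ne' hκ, fun θ => ?_⟩
  obtain ⟨a, b, hab, hR⟩ := exists_openRectangle_subset θ
  rw [ENNReal.coe_toNNReal hκ, ← ENNReal.mul_rpow_of_nonneg _ _ (by norm_num),
    enorm_mongeEmbedding_antipodalDiracs_sub]
  refine ENNReal.rpow_le_rpow ?_ (by norm_num)
  set R := openRectangle (|Real.sin θ| / 2) a b
  have hmeas : uniformDisc R = (volume unitDisc)⁻¹ * (ENNReal.ofReal (|Real.sin θ| / 2) *
      ENNReal.ofReal (3 / 10)) := by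
    rw [uniformDisc, Measure.smul_apply, Measure.restrict_apply (measurableSet_openRectangle _ _ _),
      inter_eq_left.2 fun x hx => (hR x hx).1, volume_openRectangle, hab, smul_eq_mul]
  have hsin : ‖Real.sin θ‖ₑ = 2 * ENNReal.ofReal (|Real.sin θ| / 2) := by
    rw [Real.enorm_eq_ofReal_abs, ← ENNReal.ofReal_ofNat 2, ← ENNReal.ofReal_mul (by norm_num)]
    congr 1
    ring
  calc c * ‖Real.sin θ‖ₑ = ∫⁻ _ in R, 2 ∂uniformDisc := by
        rw [setLIntegral_const, hmeas, hsin]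
        ring
    _ ≤ ∫⁻ x in R, ‖nearestAntipodal (circlePoint θ) x - nearestAntipodal (circlePoint 0) x‖ₑ ^
          (2 : ℝ) ∂uniformDisc := by
        refine setLIntegral_mono' (measurableSet_openRectangle _ _ _) fun x hx => ?_
        rw [← ofReal_norm, ENNReal.ofReal_rpow_of_nonneg (norm_nonneg _) (by norm_num),
          Real.rpow_two]
        exact (ENNReal.ofReal_ofNat 2).symm.le.trans (ENNReal.ofReal_le_ofReal (hR x hx).2)
    _ ≤ _ := setLIntegral_le_lintegral _ _

/-- The plan sends `circlePoint θ` to `w` and its antipode to `-w`, both at the same distance. -/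
theorem wasserstein_antipodalDiracs_le (θ φ : ℝ) {w : EuclideanSpace ℝ (Fin 2)}
    (hw : w = circlePoint φ ∨ w = -circlePoint φ) :
    wasserstein 2 (antipodalDiracs θ) (antipodalDiracs φ) ≤ ‖circlePoint θ - w‖ₑ := by
  have hφ : measOf (antipodalDiracs φ) =
      (2⁻¹ : ℝ≥0∞) • (Measure.dirac w + Measure.dirac (-w)) := by
    rcases hw with rfl | rfl
    · rfl
    · rw [neg_neg, add_comm]
      rfl
  let γ : Measure (EuclideanSpace ℝ (Fin 2) × EuclideanSpace ℝ (Fin 2)) :=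
    (2⁻¹ : ℝ≥0∞) • (Measure.dirac (circlePoint θ, w) + Measure.dirac (-circlePoint θ, -w))
  have hγ : γ ∈ transportPlans (measOf (antipodalDiracs θ)) (measOf (antipodalDiracs φ)) := by
    constructor
    · rw [Measure.map_smul, Measure.map_add _ _ measurable_fst,
        Measure.map_dirac' measurable_fst, Measure.map_dirac' measurable_fst]
      rfl
    · rw [Measure.map_smul, Measure.map_add _ _ measurable_snd,
        Measure.map_dirac' measurable_snd, Measure.map_dirac' measurable_snd, hφ]
  have hcost : ∫⁻ z, ‖z.1 - z.2‖ₑ ^ (2 : ℝ) ∂γ = ‖circlePoint θ - w‖ₑ ^ (2 : ℝ) := by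
    have hneg : ‖-circlePoint θ - -w‖ₑ = ‖circlePoint θ - w‖ₑ := by
      rw [← neg_sub', enorm_neg]
    rw [lintegral_smul_measure, lintegral_add_measure, lintegral_dirac' _ (by fun_prop),
      lintegral_dirac' _ (by fun_prop), hneg, ← two_mul, smul_eq_mul, ← mul_assoc,
      ENNReal.inv_mul_cancel two_ne_zero ENNReal.ofNat_ne_top, one_mul]
  rw [wasserstein, one_div, ENNReal.rpow_inv_le_iff two_pos, ← hcost]
  exact iInf₂_le γ hγ

/-- Matching `circlePoint θ` with the nearer of `±circlePoint 0` costs `2 - 2|cos θ| ≤ 2 sin² θ`,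
whatever the size of `θ`. -/
theorem wasserstein_antipodalDiracs_zero_le (θ : ℝ) :
    wasserstein 2 (antipodalDiracs θ) (antipodalDiracs 0) ≤ 2 * ‖Real.sin θ‖ₑ := by
  have key (w : EuclideanSpace ℝ (Fin 2)) (hw : w = circlePoint 0 ∨ w = -circlePoint 0)
      (h : ‖circlePoint θ - w‖ ^ 2 ≤ (2 * |Real.sin θ|) ^ 2) :
      wasserstein 2 (antipodalDiracs θ) (antipodalDiracs 0) ≤ 2 * ‖Real.sin θ‖ₑ := by
    refine (wasserstein_antipodalDiracs_le θ 0 hw).trans ?_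
    have h2 : 2 * ‖Real.sin θ‖ₑ = ENNReal.ofReal (2 * |Real.sin θ|) := by
      rw [Real.enorm_eq_ofReal_abs, ENNReal.ofReal_mul zero_le_two, ENNReal.ofReal_ofNat]
    rw [← ofReal_norm, h2]
    exact ENNReal.ofReal_le_ofReal
      ((pow_le_pow_iff_left₀ (norm_nonneg _) (by positivity) two_ne_zero).1 h)
  have h1 := Real.sin_sq_add_cos_sq θ
  have h2 := Real.neg_one_le_cos θ
  have h3 := Real.cos_le_one θ
  rcases le_total 0 (Real.cos θ) with hc | hc
  · refine key _ (.inl rfl) ?_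
    rw [norm_sub_sq_real, norm_circlePoint, norm_circlePoint, circlePoint_inner_circlePoint_zero,
      mul_pow, sq_abs]
    nlinarith
  · refine key _ (.inr rfl) ?_
    rw [norm_sub_sq_real, norm_neg, inner_neg_right, norm_circlePoint, norm_circlePoint,
      circlePoint_inner_circlePoint_zero, mul_pow, sq_abs]
    nlinarith

/-- The left side is at most `C * 2 ^ α * |sin θ| ^ (α - 1/2)` times `|sin θ| ^ (1/2)`, and the
first factor falls below `κ` as `θ → 0`. -/
theorem exists_mul_wasserstein_rpow_lt {α : ℝ} (hα : 1 / 2 < α) (C : ℝ≥0) {δ : ℝ} (hδ : 0 < δ) :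
    ∃ θ ∈ Ioo (0 : ℝ) δ, C * wasserstein 2 (antipodalDiracs θ) (antipodalDiracs 0) ^ α <
      ‖mongeEmbedding uniformDisc (antipodalDiracs θ) -
        mongeEmbedding uniformDisc (antipodalDiracs 0)‖ₑ := by
  obtain ⟨κ, hκ, hle⟩ := exists_le_enorm_mongeEmbedding_antipodalDiracs_sub
  have hβ : 0 < α - 1 / 2 := by linarith
  have hlim : Tendsto (fun θ : ℝ => C * 2 ^ α * ‖Real.sin θ‖₊ ^ (α - 1 / 2)) (𝓝[>] 0) (𝓝 0) := by
    have hc : Continuous fun θ : ℝ => C * 2 ^ α * ‖Real.sin θ‖₊ ^ (α - 1 / 2) :=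
      continuous_const.mul
        ((NNReal.continuous_rpow_const hβ.le).comp (Real.continuous_sin.nnnorm))
    have := hc.tendsto 0
    simp only [Real.sin_zero, nnnorm_zero, NNReal.zero_rpow hβ.ne', mul_zero] at this
    exact this.mono_left nhdsWithin_le_nhds
  -- The cap at `1 < π` ensures `sin θ > 0`, needed for strictness.
  have hIoo : Ioo (0 : ℝ) (min δ 1) ∈ 𝓝[>] (0 : ℝ) := Ioo_mem_nhdsGT (by positivity)
  obtain ⟨θ, hθ, hlt⟩ := Filter.nonempty_of_mem
    (Filter.inter_mem hIoo (hlim.eventually_lt_const hκ))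
  refine ⟨θ, ⟨hθ.1, hθ.2.trans_le (min_le_left _ _)⟩, lt_of_lt_of_le ?_ (hle θ)⟩
  have hsin : 0 < ‖Real.sin θ‖₊ := by
    have : 0 < Real.sin θ := Real.sin_pos_of_pos_of_lt_pi hθ.1
      (by linarith [hθ.2, min_le_right δ 1, Real.pi_gt_three])
    exact nnnorm_pos.2 this.ne'
  calc (C : ℝ≥0∞) * wasserstein 2 (antipodalDiracs θ) (antipodalDiracs 0) ^ α
      ≤ C * (2 * ‖Real.sin θ‖ₑ) ^ α := by
        gcongr
        exact wasserstein_antipodalDiracs_zero_le θ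
    _ = ((C * 2 ^ α * ‖Real.sin θ‖₊ ^ (α - 1 / 2) * ‖Real.sin θ‖₊ ^ (1 / 2 : ℝ) : ℝ≥0) : ℝ≥0∞) := by
        rw [mul_assoc, ← NNReal.rpow_add hsin.ne', sub_add_cancel, mul_assoc, ← NNReal.mul_rpow,
          ENNReal.coe_mul, ENNReal.coe_rpow_of_nonneg _ (by linarith)]
        rfl
    _ < ((κ * ‖Real.sin θ‖₊ ^ (1 / 2 : ℝ) : ℝ≥0) : ℝ≥0∞) := by
        rw [ENNReal.coe_lt_coe]
        exact mul_lt_mul_of_pos_right hlt (NNReal.rpow_pos hsin)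
    _ = κ * ‖Real.sin θ‖ₑ ^ (1 / 2 : ℝ) := by
        rw [ENNReal.coe_mul, ENNReal.coe_rpow_of_nonneg _ (by norm_num)]
        rfl

theorem exists_mul_wasserstein_rpow_half_le :
    ∃ C : ℝ≥0, 0 < C ∧ ∀ θ : ℝ,
      C * wasserstein 2 (antipodalDiracs θ) (antipodalDiracs 0) ^ (1 / 2 : ℝ) ≤
        ‖mongeEmbedding uniformDisc (antipodalDiracs θ) -
          mongeEmbedding uniformDisc (antipodalDiracs 0)‖ₑ := by
  obtain ⟨κ, hκ, hle⟩ := exists_le_enorm_mongeEmbedding_antipodalDiracs_sub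
  have h2 : (2 : ℝ≥0) ^ (1 / 2 : ℝ) ≠ 0 := (NNReal.rpow_pos two_pos).ne'
  refine ⟨κ / 2 ^ (1 / 2 : ℝ), div_pos hκ (NNReal.rpow_pos two_pos), fun θ => ?_⟩
  refine le_trans ?_ (hle θ)
  calc ((κ / 2 ^ (1 / 2 : ℝ) : ℝ≥0) : ℝ≥0∞) *
        wasserstein 2 (antipodalDiracs θ) (antipodalDiracs 0) ^ (1 / 2 : ℝ)
      ≤ ((κ / 2 ^ (1 / 2 : ℝ) : ℝ≥0) : ℝ≥0∞) * (2 * ‖Real.sin θ‖ₑ) ^ (1 / 2 : ℝ) := by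
        gcongr
        exact wasserstein_antipodalDiracs_zero_le θ
    _ = ((κ / 2 ^ (1 / 2 : ℝ) * 2 ^ (1 / 2 : ℝ) : ℝ≥0) : ℝ≥0∞) * ‖Real.sin θ‖ₑ ^ (1 / 2 : ℝ) := by
        rw [ENNReal.mul_rpow_of_nonneg _ _ (by norm_num), ← mul_assoc, ENNReal.coe_mul,
          ENNReal.coe_rpow_of_nonneg _ (by norm_num)]
        rfl
    _ = κ * ‖Real.sin θ‖ₑ ^ (1 / 2 : ℝ) := by rw [div_mul_cancel₀ _ h2]

end Disc

end

theorem proposition2p3 :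
    -- for all compact convex `X`, `Y` and every probability density `ρ` on `X`:
    (∀ (d : ℕ) (X Y : Set (EuclideanSpace ℝ (Fin d))),
      IsCompact X → Convex ℝ X → IsCompact Y → Convex ℝ Y →
      ∀ ρ : Measure (EuclideanSpace ℝ (Fin d)),
        IsProbabilityMeasure ρ → ρ ≪ volume → ρ Xᶜ = 0 →
        -- the Monge embedding is well defined
        (∀ μ : probOn Y, IsMongeMap ρ (measOf μ) (mongeEmbedding ρ μ) ∧
          ∀ T : EuclideanSpace ℝ (Fin d) → EuclideanSpace ℝ (Fin d),
            IsMongeMap ρ (measOf μ) T → T =ᵐ[ρ] mongeEmbedding ρ μ) ∧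
        -- (i) it is reverse-Lipschitz
        (∀ μ ν : probOn Y, wasserstein 2 μ ν ≤ ‖mongeEmbedding ρ μ - mongeEmbedding ρ ν‖ₑ) ∧
        -- (ii) it is continuous, for weak convergence and for every `W_p`
        Continuous (fun μ : probOn Y => mongeEmbedding ρ μ) ∧
        (∀ p : ℝ, 1 ≤ p → ∀ μ : probOn Y, ∀ ε : ℝ≥0∞, 0 < ε → ∃ δ : ℝ≥0∞, 0 < δ ∧
          ∀ ν : probOn Y, wasserstein p μ ν < δ →
            ‖mongeEmbedding ρ μ - mongeEmbedding ρ ν‖ₑ < ε)) ∧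
    -- (iii) for the uniform measure on the unit disc it is no better than `1/2`-Hölder
    (∃ C : ℝ≥0, 0 < C ∧ ∀ θ ∈ Icc (0 : ℝ) (2 * Real.pi),
      C * wasserstein 2 (antipodalDiracs θ) (antipodalDiracs 0) ^ (1 / 2 : ℝ) ≤
        ‖mongeEmbedding uniformDisc (antipodalDiracs θ) -
          mongeEmbedding uniformDisc (antipodalDiracs 0)‖ₑ) ∧
    (∀ α : ℝ, 1 / 2 < α → ∀ C : ℝ≥0, ∀ δ : ℝ, 0 < δ → ∃ θ ∈ Ioo (0 : ℝ) δ,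
      C * wasserstein 2 (antipodalDiracs θ) (antipodalDiracs 0) ^ α <
        ‖mongeEmbedding uniformDisc (antipodalDiracs θ) -
          mongeEmbedding uniformDisc (antipodalDiracs 0)‖ₑ) ∧
    (∀ α : ℝ, 1 / 2 < α → ¬ ∃ C : ℝ≥0, ∀ μ ν : probOn unitDisc,
      ‖mongeEmbedding uniformDisc μ - mongeEmbedding uniformDisc ν‖ₑ ≤
        C * wasserstein 2 μ ν ^ α) := by
  refine ⟨fun d X Y hX _ hY _ ρ _ hρ hρX => ⟨mongeEmbedding_spec hX hY hρ hρX, fun μ ν => ?_,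
    continuous_mongeEmbedding hX hY hρ hρX, fun p hp μ ε hε =>
      exists_wasserstein_lt_of_continuous (continuous_mongeEmbedding hX hY hρ hρX) hp μ hε⟩,
    ?_, fun α hα C δ hδ => exists_mul_wasserstein_rpow_lt hα C hδ, ?_⟩
  · exact wasserstein_two_le_of_map ρ _ _ (mongeEmbedding_spec hX hY hρ hρX μ).1.map_eq
      (mongeEmbedding_spec hX hY hρ hρX ν).1.map_eq
  · obtain ⟨C, hC, h⟩ := exists_mul_wasserstein_rpow_half_le
    exact ⟨C, hC, fun θ _ => h θ⟩
  · rintro α hα ⟨C, hC⟩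
    obtain ⟨θ, -, hθ⟩ := exists_mul_wasserstein_rpow_lt hα C one_pos
    exact hθ.not_ge (hC _ _)
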